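/- Let $X$ be a real Banach space that admits a $C^1$ Lipschitz bump function, i.e. a Lipschitz $C^1$ function $b:X\to\mathbb R$ whose support $\overline{\{b\neq 0\}}$ is bounded and non-empty. Let $M$ be a connected paracompact Hausdorff $C^1$ Banach manifold modeled on $X$, with a continuous map $\|\cdot\|_M:TM\to[0,\infty)$ making it a $C^1$ Finsler manifold in the sense of Palais. That is: (P1) for every $x\in M$ the restriction $\|\cdot\|_x$ of $\|\cdot\|_M$ to $T_xM$ is a norm, and for every chart $\varphi:U\to X$ with $x\in U$ the norm $v\mapsto\|d\varphi^{-1}(\varphi(x))(v)\|_x$ on $X$ is equivalent to the norm of $X$; (P2) for every $x_0\in M$, every $\varepsilon>0$ and every chart $\varphi:U\to X$ with $x_0\in U$ there is an open neighborhood $W\subset U$ of $x_0$ such that for all $x\in W$ and $v\in X$ $$\tfrac1{1+\varepsilon}\|d\varphi^{-1}(\varphi(x_0))(v)\|_{x_0}\le\|d\varphi^{-1}(\varphi(x))(v)\|_x\le(1+\varepsilon)\|d\varphi^{-1}(\varphi(x_0))(v)\|_{x_0}.$$ Let $d(p,q)$ be the Finsler distance, the infimum of the lengths $\ell(c)=\int_a^b\|c'(t)\|_{c(t)}\,dt$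 of the piecewise $C^1$ paths $c:[a,b]\to M$ from $p$ to $q$, and assume that $M$ is complete for $d$. Let $\Omega\subset M$ be a ($d$-)bounded open set with $\partial\Omega\ne\emptyset$, and let $h:\partial\Omega\to\mathbb R$ be $1$-Lipschitz for $d$, i.e. $|h(y)-h(z)|\le d(y,z)$ for all $y,z\in\partial\Omega$. For $u:\overline\Omega\to\mathbb R$ and $x\in\Omega$ let $D^-u(x)\subset T_xM^*$ (respectively $D^+u(x)$) be the set of all $dg(x)$, where $g:M\to\mathbb R$ is $C^1$ and $u-g$ attains a local minimum (respectively a local maximum) at $x$. On $T_xM^*$ use the dual norm $\|\Delta\|_x=\sup\{|\Delta(\xi)|:\xi\in T_xM,\ \|\xi\|_x=1\}$. A function $u:\overline\Omega\to\mathbb R$ is a viscosity subsolution of the eikonal problem $$\|du(x)\|_x=1\ \text{ for } x\in\Omega,\qquad u=h\ \text{ on }\partial\Omega,$$ if $u$ is upper semicontinuous, $\|\Lambda\|_x\le1$ for all $x\in\Omega$ and $\Lambda\in D^+u(x)$, and $u\le h$ on $\partial\Omega$. It is a viscosity supersolution if $u$ is lower semicontinuous, $\|\Delta\|_x\ge1$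 for all $x\in\Omega$ and $\Delta\in D^-u(x)$, and $u\ge h$ on $\partial\Omega$. It is a viscosity solution if it is both. Then the function $u:\overline\Omega\to\mathbb R$ defined by $u(x)=\inf\{h(y)+d(y,x):y\in\partial\Omega\}$ is a viscosity solution of this eikonal problem, and it is the only one. -/

import Mathlib

open Set Filter Topology
open scoped Manifold ContDiff

noncomputable section

/-- The Banach space `X` admits a Lipschitz bump function of class `C^1`: a Lipschitz `C^1` function
whose support (the closure of the set where it does not vanish) is bounded and nonempty. -/
def HasC1LipschitzBump (X : Type*) [NormedAddCommGroup X] [NormedSpace ℝ X] : Prop :=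
  ∃ b : X → ℝ, ContDiff ℝ 1 b ∧ (∃ K, LipschitzWith K b) ∧
    Bornology.IsBounded (tsupport b) ∧ (tsupport b).Nonempty

/-- For a family `N` of norms on the tangent spaces of `M`, a chart `φ` and a point `y` of the
target of `φ`: the function `v ↦ ‖d(φ⁻¹)(y)(v)‖` on `X`, the norm being taken in the tangent space
at `φ⁻¹(y)`. -/
def chartNorm {X M : Type*} [NormedAddCommGroup X] [NormedSpace ℝ X]
    [TopologicalSpace M] [ChartedSpace X M]
    (N : ∀ x : M, Seminorm ℝ (TangentSpace 𝓘(ℝ, X) x))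
    (φ : OpenPartialHomeomorph M X) (y v : X) : ℝ :=
  N (φ.symm y) (mfderiv 𝓘(ℝ, X) 𝓘(ℝ, X) φ.symm y v)

/-- A `C^1` Finsler structure in the sense of Palais on a `C^1` manifold `M` modeled on `X`.
Charts are those of the maximal `C^1` atlas. -/
structure PalaisFinsler (X M : Type*) [NormedAddCommGroup X] [NormedSpace ℝ X]
    [TopologicalSpace M] [ChartedSpace X M] [IsManifold 𝓘(ℝ, X) 1 M] where
  /-- The norm on each tangent space. -/
  nrm : ∀ x : M, Seminorm ℝ (TangentSpace 𝓘(ℝ, X) x)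
  eq_zero_of_nrm_eq_zero : ∀ (x : M) (v : TangentSpace 𝓘(ℝ, X) x), nrm x v = 0 → v = 0
  /-- The norm is continuous on the tangent bundle. -/
  continuous_nrm : Continuous fun p : TangentBundle 𝓘(ℝ, X) M => nrm p.1 p.2
  /-- In every chart the norms are equivalent to the norm of the model space. -/
  equivalent : ∀ φ ∈ IsManifold.maximalAtlas 𝓘(ℝ, X) 1 M, ∀ x ∈ φ.source,
    ∃ K : ℝ, 0 < K ∧ ∀ v : X,
      K⁻¹ * ‖v‖ ≤ chartNorm nrm φ (φ x) v ∧ chartNorm nrm φ (φ x) v ≤ K * ‖v‖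
  /-- The Palais condition. -/
  palais : ∀ φ ∈ IsManifold.maximalAtlas 𝓘(ℝ, X) 1 M, ∀ x₀ ∈ φ.source, ∀ ε : ℝ, 0 < ε →
    ∃ W : Set M, IsOpen W ∧ x₀ ∈ W ∧ W ⊆ φ.source ∧ ∀ x ∈ W, ∀ v : X,
      (1 + ε)⁻¹ * chartNorm nrm φ (φ x₀) v ≤ chartNorm nrm φ (φ x) v ∧
      chartNorm nrm φ (φ x) v ≤ (1 + ε) * chartNorm nrm φ (φ x₀) v

/-- `c` restricted to `[a, b]` is a piecewise `C^1` path: for some partition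
`a = t 0 ≤ t 1 ≤ ⋯ ≤ t n = b` it is of class `C^1` on each closed interval `[t i, t (i + 1)]`. -/
def IsPiecewiseC1Path (X : Type*) {M : Type*} [NormedAddCommGroup X] [NormedSpace ℝ X]
    [TopologicalSpace M] [ChartedSpace X M] (c : ℝ → M) (a b : ℝ) : Prop :=
  ∃ (n : ℕ) (t : ℕ → ℝ), Monotone t ∧ t 0 = a ∧ t n = b ∧
    ∀ i < n, ContMDiffOn 𝓘(ℝ, ℝ) 𝓘(ℝ, X) 1 c (Icc (t i) (t (i + 1)))

namespace PalaisFinsler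

variable {X M : Type*} [NormedAddCommGroup X] [NormedSpace ℝ X]
  [TopologicalSpace M] [ChartedSpace X M] [IsManifold 𝓘(ℝ, X) 1 M]

/-- The length `∫_a^b ‖c'(t)‖ dt` of a path. (A piecewise `C^1` path is differentiable at all but
finitely many `t ∈ [a, b]`, and the integrand is bounded and piecewise continuous.) -/
def pathLength (F : PalaisFinsler X M) (c : ℝ → M) (a b : ℝ) : ℝ :=
  ∫ t in a..b, F.nrm (c t) (mfderiv 𝓘(ℝ, ℝ) 𝓘(ℝ, X) c t (1 : ℝ))

/-- The Finsler distance: the infimum of the lengths of the piecewise `C^1` paths from `p` to `q`.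
(On a connected manifold there is such a path, and lengths are nonnegative, so that this is a
genuine infimum.) -/
def fdist (F : PalaisFinsler X M) (p q : M) : ℝ :=
  sInf {r | ∃ (c : ℝ → M) (a b : ℝ), a ≤ b ∧ IsPiecewiseC1Path X c a b ∧
    c a = p ∧ c b = q ∧ F.pathLength c a b = r}

/-- Completeness for the Finsler distance: Cauchy sequences converge. -/
def IsComplete (F : PalaisFinsler X M) : Prop :=
  ∀ s : ℕ → M, (∀ ε > 0, ∃ n₀ : ℕ, ∀ m ≥ n₀, ∀ n ≥ n₀, F.fdist (s m) (s n) < ε) →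
    ∃ x : M, Tendsto (fun n => F.fdist (s n) x) atTop (𝓝 0)

/-- Boundedness for the Finsler distance. -/
def IsBdd (F : PalaisFinsler X M) (A : Set M) : Prop :=
  ∃ C : ℝ, ∀ p ∈ A, ∀ q ∈ A, F.fdist p q ≤ C

/-- The dual norm `‖Δ‖_x = sup {|Δ ξ| : ‖ξ‖_x = 1}` on the dual of the tangent space at `x`. -/
def dualNorm (F : PalaisFinsler X M) (x : M) (Δ : TangentSpace 𝓘(ℝ, X) x →L[ℝ] ℝ) : ℝ :=
  sSup {r | ∃ ξ : TangentSpace 𝓘(ℝ, X) x, F.nrm x ξ = 1 ∧ |Δ ξ| = r}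

end PalaisFinsler

section Subdifferential

variable (X : Type*) {M : Type*} [NormedAddCommGroup X] [NormedSpace ℝ X]
  [TopologicalSpace M] [ChartedSpace X M]

/-- The set `D⁻f(x)` of subdifferentials at `x` of a function `f` defined on `A ⊆ M`
(equivalently, of `f` extended by `+∞` to `M`). -/
def subdifferential {A : Set M} (f : A → ℝ) (x : A) :
    Set (TangentSpace 𝓘(ℝ, X) (x : M) →L[ℝ] ℝ) :=
  {Δ | ∃ g : M → ℝ, ContMDiff 𝓘(ℝ, X) 𝓘(ℝ, ℝ) 1 g ∧
    IsLocalMin (fun y : A => f y - g y) x ∧ mfderiv 𝓘(ℝ, X) 𝓘(ℝ, ℝ) g (x : M) = Δ}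

/-- The set `D⁺f(x)` of superdifferentials at `x` of a function `f` defined on `A ⊆ M`
(equivalently, of `f` extended by `-∞` to `M`). -/
def superdifferential {A : Set M} (f : A → ℝ) (x : A) :
    Set (TangentSpace 𝓘(ℝ, X) (x : M) →L[ℝ] ℝ) :=
  {Δ | ∃ g : M → ℝ, ContMDiff 𝓘(ℝ, X) 𝓘(ℝ, ℝ) 1 g ∧
    IsLocalMax (fun y : A => f y - g y) x ∧ mfderiv 𝓘(ℝ, X) 𝓘(ℝ, ℝ) g (x : M) = Δ}

end Subdifferential

namespace PalaisFinsler

variable {X M : Type*} [NormedAddCommGroup X] [NormedSpace ℝ X]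
  [TopologicalSpace M] [ChartedSpace X M] [IsManifold 𝓘(ℝ, X) 1 M]

/-- Viscosity subsolutions of `‖du(x)‖_x = 1` in `Ω`, `u = h` on `∂Ω`. -/
structure IsViscositySubsolution (F : PalaisFinsler X M) (Ω : Set M) (h : frontier Ω → ℝ)
    (u : closure Ω → ℝ) : Prop where
  upperSemicontinuous : UpperSemicontinuous u
  dualNorm_le : ∀ x : closure Ω, (x : M) ∈ Ω → ∀ Λ ∈ superdifferential X u x,
    F.dualNorm (x : M) Λ ≤ 1
  boundary_le : ∀ y : frontier Ω, u ⟨y, frontier_subset_closure y.2⟩ ≤ h y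

/-- Viscosity supersolutions of `‖du(x)‖_x = 1` in `Ω`, `u = h` on `∂Ω`. -/
structure IsViscositySupersolution (F : PalaisFinsler X M) (Ω : Set M) (h : frontier Ω → ℝ)
    (u : closure Ω → ℝ) : Prop where
  lowerSemicontinuous : LowerSemicontinuous u
  le_dualNorm : ∀ x : closure Ω, (x : M) ∈ Ω → ∀ Δ ∈ subdifferential X u x,
    1 ≤ F.dualNorm (x : M) Δ
  le_boundary : ∀ y : frontier Ω, h y ≤ u ⟨y, frontier_subset_closure y.2⟩

/-- Viscosity solutions of `‖du(x)‖_x = 1` in `Ω`, `u = h` on `∂Ω`. -/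
def IsViscositySolution (F : PalaisFinsler X M) (Ω : Set M) (h : frontier Ω → ℝ)
    (u : closure Ω → ℝ) : Prop :=
  F.IsViscositySubsolution Ω h u ∧ F.IsViscositySupersolution Ω h u

/-- The function `x ↦ inf {h y + d(y, x) : y ∈ ∂Ω}` on the closure of `Ω`. -/
def distanceSolution (F : PalaisFinsler X M) (Ω : Set M) (h : frontier Ω → ℝ) :
    closure Ω → ℝ :=
  fun x => ⨅ y : frontier Ω, (h y + F.fdist (y : M) (x : M))

end PalaisFinsler

end

/-! The function `u` is `1`-Lipschitz and extends `h`. Hence if `u - g` has a local maximum at `x`,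
then `g` decreases at rate at most `1` around `x`, and `dg(x)` has norm at most `1`. If `u - g` has
a local minimum at `x` and `dg(x)` had norm less than `1`, then `u` would decrease at rate at most
`κ < 1` around `x`. But moving from `x` along an almost minimizing path towards an almost optimal
boundary point makes `u` decrease at rate almost `1`.

For uniqueness let `v` be a solution, continuous by the two semicontinuities. The viscosity
inequalities are first converted into metric ones. The subsolution property gives `v y - v x ≤ L *
d(x, y)` for `y` near `x`, for every `L > 1` (`eventually_sub_le_of_superdifferential`). The
supersolution property says that `v` never stays above a cone of slope `θ < 1` with vertex on its
graph (`not_eventually_sub_le_of_subdifferential`). Both are proved in a chart, where by the Palais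
condition the distance is almost a fixed norm (`exists_local_comparison`). This norm need not be
smooth, so the variables are doubled and the smooth variational principle, available thanks to the
bump function, is applied on `X × X`. At the resulting minimum the two partial derivatives are
almost opposite, so a bound coming from the norm in one variable passes to a `C^1` test function in
the other.

The growth bound, integrated along paths up to their first exit from `Ω`, gives `|v x - h y| ≤ d(x,
y)` and so `v ≤ u`. Conversely, for `θ < 1`, Ekeland's principle on the complete space `closure Ω`
yields from `x` a point `z` with `v z + θ * d(x, z) ≤ v x` above whose cone of slope `θ` the graph
of `v` lies. Such a `z` cannot be in `Ω`, hence `v z = h z`, and `v x ≥ u x - (1 - θ) * d(x, z)`. As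
`Ω` is bounded, letting `θ` tend to `1` gives `v ≥ u`. -/

/-! ### Bump functions, the smooth variational principle and doubling of variables. -/

/-- A Lipschitz `C^1` function with values in `[0, 1]`, equal to `1` near the origin and vanishing
off the open unit ball. -/
structure IsUnitBump {E : Type*} [NormedAddCommGroup E] [NormedSpace ℝ E] (β : E → ℝ) : Prop where
  contDiff : ContDiff ℝ 1 β
  lipschitz : ∃ K, LipschitzWith K β
  nonneg : ∀ x, 0 ≤ β x
  le_one : ∀ x, β x ≤ 1
  eventually_eq_one : ∀ᶠ x in 𝓝 (0 : E), β x = 1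
  eq_zero : ∀ x, 1 ≤ ‖x‖ → β x = 0

/-- After normalization to the value `1` at `x₀`, composition with a real bump function centred at
`1` with outer radius `1` flattens the top to the constant `1` and still sends the value `0` to `0`.
-/
theorem HasC1LipschitzBump.exists_isUnitBump {X : Type*} [NormedAddCommGroup X] [NormedSpace ℝ X]
    (hX : HasC1LipschitzBump X) : ∃ β : X → ℝ, IsUnitBump β := by
  obtain ⟨b, hb, ⟨K, hK⟩, hbd, hne⟩ := hX
  have : (Function.support b).Nonempty := by
    rw [tsupport, closure_nonempty_iff] at hne
    exact hne
  obtain ⟨x₀, hx₀⟩ := this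
  have hx₀ : b x₀ ≠ 0 := hx₀
  obtain ⟨R, hR0, hR⟩ := hbd.subset_ball_lt 0 x₀
  let τ : ContDiffBump (1 : ℝ) := ⟨1 / 2, 1, by norm_num, by norm_num⟩
  obtain ⟨C, hC⟩ := (τ.contDiff (n := 1)).lipschitzWith_of_hasCompactSupport
    τ.hasCompactSupport (by norm_num)
  have hlin : LipschitzWith ‖R‖₊ fun x : X => x₀ + R • x := by
    refine LipschitzWith.of_dist_le_mul fun x y => ?_
    rw [dist_add_left, dist_smul₀]
    rfl
  have hscale : LipschitzWith ‖(b x₀)⁻¹‖₊ fun t : ℝ => (b x₀)⁻¹ * t := by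
    refine LipschitzWith.of_dist_le_mul fun x y => ?_
    rw [Real.dist_eq, ← mul_sub, abs_mul]
    rfl
  have hcont : Continuous fun x : X => (b x₀)⁻¹ * b (x₀ + R • x) := by
    have := hb.continuous
    fun_prop
  refine ⟨fun x => τ ((b x₀)⁻¹ * b (x₀ + R • x)), ?_, ⟨_, hC.comp (hscale.comp (hK.comp hlin))⟩,
    fun x => τ.nonneg, fun x => τ.le_one, ?_, ?_⟩
  · exact τ.contDiff.comp (contDiff_const.mul (hb.comp (contDiff_const.add
      (contDiff_const.smul contDiff_id))))
  · have h0 : Tendsto (fun x : X => (b x₀)⁻¹ * b (x₀ + R • x)) (𝓝 0) (𝓝 1) :=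
      hcont.tendsto' _ _ (by simp [inv_mul_cancel₀ hx₀])
    filter_upwards [h0 (Metric.closedBall_mem_nhds (1 : ℝ) (by norm_num : (0 : ℝ) < 1 / 2))]
      with x hx
    exact τ.one_of_mem_closedBall hx
  · intro x hx
    have : b (x₀ + R • x) = 0 := by
      by_contra h
      have := hR (subset_tsupport b h)
      rw [Metric.mem_ball, dist_self_add_left, norm_smul, Real.norm_of_nonneg hR0.le] at this
      nlinarith
    rw [this, mul_zero]
    apply τ.zero_of_le_dist
    simp [τ]

theorem IsUnitBump.prod {E E' : Type*} [NormedAddCommGroup E] [NormedSpace ℝ E]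
    [NormedAddCommGroup E'] [NormedSpace ℝ E'] {β : E → ℝ} {β' : E' → ℝ} (h : IsUnitBump β)
    (h' : IsUnitBump β') : IsUnitBump fun p : E × E' => β p.1 * β' p.2 := by
  obtain ⟨K, hK⟩ := h.lipschitz
  obtain ⟨K', hK'⟩ := h'.lipschitz
  refine ⟨(h.contDiff.comp contDiff_fst).mul (h'.contDiff.comp contDiff_snd), ⟨K + K', ?_⟩,
    fun x => mul_nonneg (h.nonneg _) (h'.nonneg _),
    fun x => mul_le_one₀ (h.le_one _) (h'.nonneg _) (h'.le_one _), ?_, ?_⟩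
  · refine LipschitzWith.of_dist_le_mul fun p q => ?_
    have h1 := hK.dist_le_mul p.1 q.1
    have h2 := hK'.dist_le_mul p.2 q.2
    rw [Real.dist_eq] at h1 h2 ⊢
    have e : β p.1 * β' p.2 - β q.1 * β' q.2
      = (β p.1 - β q.1) * β' p.2 + β q.1 * (β' p.2 - β' q.2) := by ring
    have d1 : dist p.1 q.1 ≤ dist p q := le_max_left _ _
    have d2 : dist p.2 q.2 ≤ dist p q := le_max_right _ _
    rw [e]
    refine (abs_add_le _ _).trans ?_
    rw [abs_mul, abs_mul, abs_of_nonneg (h'.nonneg p.2), abs_of_nonneg (h.nonneg q.1)]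
    have a1 := mul_le_of_le_one_right (abs_nonneg (β p.1 - β q.1)) (h'.le_one p.2)
    have a2 := mul_le_of_le_one_left (abs_nonneg (β' p.2 - β' q.2)) (h.le_one q.1)
    have b1 := mul_le_mul_of_nonneg_left d1 K.2
    have b2 := mul_le_mul_of_nonneg_left d2 K'.2
    simp only [NNReal.val_eq_coe] at b1 b2
    push_cast
    linarith
  · have t1 : Tendsto (Prod.fst : E × E' → E) (𝓝 0) (𝓝 0) := continuous_fst.tendsto' _ _ rfl
    have t2 : Tendsto (Prod.snd : E × E' → E') (𝓝 0) (𝓝 0) := continuous_snd.tendsto' _ _ rfl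
    filter_upwards [t1.eventually h.eventually_eq_one, t2.eventually h'.eventually_eq_one]
      with p h1 h2
    rw [h1, h2, one_mul]
  · intro p hp
    rcases le_max_iff.1 (Prod.norm_def p ▸ hp) with hp | hp
    · rw [h.eq_zero _ hp, zero_mul]
    · rw [h'.eq_zero _ hp, mul_zero]

/-- A smooth variational principle of Deville, Godefroy and Zizler. -/
theorem IsUnitBump.exists_perturbation_isMinOn {E : Type*} [NormedAddCommGroup E] [NormedSpace ℝ E]
    [CompleteSpace E] {β : E → ℝ} (hβ : IsUnitBump β) {S : Set E} (hS : IsClosed S)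
    (hne : S.Nonempty) {f : E → ℝ} (hf : ContinuousOn f S) {m : ℝ} (hm : ∀ x ∈ S, m ≤ f x)
    {η : ℝ} (hη : 0 < η) :
    ∃ G : E → ℝ, ContDiff ℝ 1 G ∧ (∀ x, |G x| ≤ η) ∧ (∀ x, ‖fderiv ℝ G x‖ ≤ η) ∧
      ∃ x₀ ∈ S, ∀ x ∈ S, f x₀ - G x₀ ≤ f x - G x := by
  obtain ⟨L, hL⟩ := hβ.lipschitz
  set η' : ℝ := η / 2 / (L + 1) with hη'
  have hL0 : (0 : ℝ) ≤ L := L.2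
  have hη'0 : 0 < η' := by positivity
  have hη'η : η' * (L + 1) = η / 2 := by rw [hη']; field_simp
  -- The weight `4⁻ᵏ` against the dilation `2ᵏ` makes both the bumps and their derivatives, of order
  -- `2⁻ᵏ`, summable.
  let a : ℕ → ℝ := fun k => η' * (1 / 2) ^ k * (1 / 2) ^ k
  have ha : ∀ k, 0 < a k := fun k => by positivity
  let B : ℕ → E → E → ℝ := fun k y x => a k * β ((2 : ℝ) ^ k • (x - y))
  have hB0 : ∀ k y x, 0 ≤ B k y x := fun k y x => mul_nonneg (ha k).le (hβ.nonneg _)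
  have hBa : ∀ k y x, B k y x ≤ a k := fun k y x => mul_le_of_le_one_right (ha k).le (hβ.le_one _)
  have haη : ∀ k, a k ≤ η / 2 * (1 / 2) ^ k := fun k => by
    have h1 : ((1 : ℝ) / 2) ^ k ≤ 1 := pow_le_one₀ (by norm_num) (by norm_num)
    have h2 : (0 : ℝ) < (1 / 2) ^ k := by positivity
    have : η' * (1 / 2) ^ k ≤ η / 2 * (1 / 2) ^ k := by gcongr; rw [← hη'η]; nlinarith
    exact (mul_le_of_le_one_right (by positivity) h1).trans this
  -- The boundedness of `G` is a premise inside the existential, so that the selected point is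
  -- defined for every `G` and the recursion below needs no side condition.
  have hsel : ∀ (k : ℕ) (G : E → ℝ), ∃ y ∈ S, (∃ C, ∀ x, G x ≤ C) →
      ∀ x ∈ S, f y - G y ≤ f x - G x + a k / 2 := by
    intro k G
    by_cases hG : ∃ C, ∀ x, G x ≤ C
    · obtain ⟨C, hC⟩ := hG
      set T := (fun x => f x - G x) '' S
      have hT : BddBelow T := ⟨m - C, by
        rintro _ ⟨x, hx, rfl⟩
        have := hm x hx
        have := hC x
        dsimp only
        linarith⟩
      obtain ⟨_, ⟨y, hy, rfl⟩, hlt⟩ := exists_lt_of_csInf_lt (hne.image _)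
        (show sInf T < sInf T + a k / 2 by linarith [ha k])
      refine ⟨y, hy, fun _ x hx => ?_⟩
      have := csInf_le hT ⟨x, hx, rfl⟩
      dsimp only at this hlt
      linarith
    · exact ⟨hne.some, hne.some_mem, fun h => absurd h hG⟩
  choose sel hselS hsel using hsel
  let Gs : ℕ → E → ℝ := fun k => Nat.rec (fun _ => 0) (fun k G x => G x + B k (sel k G) x) k
  let y : ℕ → E := fun k => sel k (Gs k)
  let u : ℕ → E → ℝ := fun k => B k (y k)
  have hGs_succ : ∀ k x, Gs (k + 1) x = Gs k x + u k x := fun k x => rfl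
  have hGs : ∀ k x, Gs k x = ∑ i ∈ Finset.range k, u i x := by
    intro k x
    induction k with
    | zero => rfl
    | succ k ih => rw [Finset.sum_range_succ, hGs_succ, ih]
  have hsum : HasSum (fun k : ℕ => η / 2 * (1 / 2) ^ k) η := by
    have := (hasSum_geometric_two).mul_left (η / 2)
    simpa using this
  have hu0 : ∀ k x, 0 ≤ u k x := fun k x => hB0 _ _ _
  have huη : ∀ k x, u k x ≤ η / 2 * (1 / 2) ^ k := fun k x => (hBa _ _ _).trans (haη k)
  have hGsle : ∀ k x, Gs k x ≤ η := fun k x => by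
    rw [hGs]
    exact (Finset.sum_le_sum fun i _ => huη i x).trans
      (sum_le_hasSum _ (fun i _ => by positivity) hsum)
  have hy : ∀ k, ∀ x ∈ S, f (y k) - Gs k (y k) ≤ f x - Gs k x + a k / 2 := fun k =>
    hsel k (Gs k) ⟨η, hGsle k⟩
  have hyS : ∀ k, y k ∈ S := fun k => hselS _ _
  -- If `y (k + 1)` were outside the support of the bump added at `y k`, the gain `a k` at `y k`
  -- would exceed the total tolerance `a k / 2 + a (k + 1) / 2`.
  have hstep : ∀ k, dist (y k) (y (k + 1)) ≤ 1 * (1 / 2) ^ k := by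
    intro k
    by_contra hlt
    push Not at hlt
    have hz : u k (y (k + 1)) = 0 := by
      have : β ((2 : ℝ) ^ k • (y (k + 1) - y k)) = 0 := by
        apply hβ.eq_zero
        rw [norm_smul, ← dist_eq_norm, dist_comm, norm_pow, Real.norm_ofNat]
        rw [one_mul, one_div, inv_pow] at hlt
        exact ((inv_lt_iff_one_lt_mul₀' (by positivity)).1 hlt).le
      show a k * β _ = 0
      rw [this, mul_zero]
    have h1 : u k (y k) = a k := by
      show a k * β _ = a k
      rw [sub_self, smul_zero, hβ.eventually_eq_one.self_of_nhds, mul_one]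
    have h2 := hy k _ (hyS (k + 1))
    have h3 := hy (k + 1) _ (hyS k)
    rw [hGs_succ, hGs_succ, hz, h1] at h3
    have h4 : a (k + 1) = a k / 4 := by simp only [a, pow_succ]; ring
    have := ha k
    linarith
  obtain ⟨x₀, hx₀⟩ := cauchySeq_tendsto_of_complete
    (cauchySeq_of_le_geometric (1 / 2) 1 (by norm_num) hstep)
  have hx₀S : x₀ ∈ S := hS.mem_of_tendsto hx₀ (Eventually.of_forall hyS)
  have hucd : ∀ k, ContDiff ℝ 1 (u k) := fun k => contDiff_const.mul
    (hβ.contDiff.comp (contDiff_const.smul (contDiff_id.sub contDiff_const)))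
  have hufd : ∀ k x, ‖fderiv ℝ (u k) x‖ ≤ η / 2 * (1 / 2) ^ k := by
    intro k x
    refine norm_fderiv_le_of_lip' ℝ (by positivity) (Eventually.of_forall fun z => ?_)
    have h1 := hL.dist_le_mul ((2 : ℝ) ^ k • (z - y k)) ((2 : ℝ) ^ k • (x - y k))
    rw [dist_smul₀, dist_sub_right, dist_eq_norm, dist_eq_norm, norm_pow, Real.norm_ofNat] at h1
    have e : u k z - u k x
        = a k * (β ((2 : ℝ) ^ k • (z - y k)) - β ((2 : ℝ) ^ k • (x - y k))) := by
      simp only [u, B]; ring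
    rw [e, norm_mul, Real.norm_of_nonneg (ha k).le]
    have h2 : ((1 : ℝ) / 2) ^ k * 2 ^ k = 1 := by rw [← mul_pow]; norm_num
    calc a k * ‖_‖ ≤ a k * (L * (2 ^ k * ‖z - x‖)) := by gcongr
      _ = η' * L * (1 / 2) ^ k * ((1 / 2) ^ k * 2 ^ k) * ‖z - x‖ := by simp only [a]; ring
      _ ≤ η / 2 * (1 / 2) ^ k * ‖z - x‖ := by
        rw [h2, mul_one, ← hη'η]; gcongr; linarith
  have hus : ∀ x, Summable fun k => u k x := fun x =>
    Summable.of_nonneg_of_le (fun k => hu0 k x) (fun k => huη k x) hsum.summable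
  have hGcd : ContDiff ℝ 1 fun x => ∑' k, u k x := by
    refine contDiff_tsum (v := fun _ k => η / 2 * (1 / 2) ^ k) hucd (fun _ _ => hsum.summable) ?_
    intro k i x hk
    have hk : k ≤ 1 := by exact_mod_cast hk
    interval_cases k
    · rw [norm_iteratedFDeriv_zero, Real.norm_of_nonneg (hu0 i x)]
      exact huη i x
    · rw [norm_iteratedFDeriv_one]
      exact hufd i x
  refine ⟨_, hGcd, fun x => ?_, fun x => ?_, x₀, hx₀S, fun x hx => ?_⟩
  · rw [abs_of_nonneg (tsum_nonneg fun k => hu0 k x)]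
    exact (hus x).tsum_le_of_sum_le fun s =>
      (Finset.sum_le_sum fun i _ => huη i x).trans
        (sum_le_hasSum _ (fun i _ => by positivity) hsum)
  · have := (hasFDerivAt_tsum hsum.summable
      (fun k x => ((hucd k).differentiable (by norm_num) x).hasFDerivAt) hufd (hus x) x).fderiv
    rw [this]
    exact tsum_of_norm_bounded hsum fun k => hufd k x
  -- The partial sums satisfy `Gs k ≤ G`, so the approximate minimality of `y k` for `f - Gs k`
  -- passes to the limit.
  · set G : E → ℝ := fun x => ∑' k, u k x with hG
    have l1 : Tendsto (fun k => f (y k) - G (y k)) atTop (𝓝 (f x₀ - G x₀)) := by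
      refine Tendsto.sub ?_ (hGcd.continuous.continuousAt.tendsto.comp hx₀)
      exact (hf x₀ hx₀S).tendsto.comp (tendsto_nhdsWithin_iff.2 ⟨hx₀, Eventually.of_forall hyS⟩)
    have l2 : Tendsto (fun k => f x - Gs k x + a k / 2) atTop (𝓝 (f x - G x + 0 / 2)) := by
      refine Tendsto.add (tendsto_const_nhds.sub ?_) (Tendsto.div_const ?_ _)
      · simp_rw [hGs]
        exact (hus x).hasSum.tendsto_sum_nat
      · refine squeeze_zero (fun k => (ha k).le) haη ?_
        exact hsum.summable.tendsto_atTop_zero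
    have := le_of_tendsto_of_tendsto' l1 l2 fun k => by
      have h1 := hy k x hx
      have h2 : Gs k (y k) ≤ G (y k) := by
        rw [hGs]
        exact (hus (y k)).sum_le_tsum _ (fun i _ => hu0 i _)
      linarith
    simpa using this

/-- Minimization with doubled variables: an approximate minimum of `f + k` on the diagonal of
`S × S` yields a minimum of `f y + k z - Ψ (y, z)` with `Ψ` of class `C^1`, nearby variables and
almost opposite partial derivatives of `Ψ`. -/
theorem IsUnitBump.exists_doubled_min {X : Type*} [NormedAddCommGroup X] [NormedSpace ℝ X]
    [CompleteSpace X] {β : X → ℝ} (hβ : IsUnitBump β) {S : Set X} (hS : IsClosed S)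
    {f k : X → ℝ} (hf : ContinuousOn f S) (hk : ContinuousOn k S) {m : ℝ}
    (hm : ∀ y ∈ S, m ≤ f y) (hk0 : ∀ z ∈ S, 0 ≤ k z) {y₁ : X} (hy₁ : y₁ ∈ S)
    {η δ : ℝ} (hη : 0 < η) (hδ : 0 < δ) :
    ∃ y ∈ S, ∃ z ∈ S, ‖y - z‖ ≤ δ ∧ f y + k z ≤ f y₁ + k y₁ + η ∧
      ∃ Ψ : X × X → ℝ, ContDiff ℝ 1 Ψ ∧
        (∀ y' ∈ S, ∀ z' ∈ S, f y + k z - Ψ (y, z) ≤ f y' + k z' - Ψ (y', z')) ∧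
        ∀ v, |fderiv ℝ Ψ (y, z) (v, v)| ≤ η * ‖v‖ := by
  -- The height of the penalty exceeds what the diagonal point `(y₁, y₁)` allows, so at the minimum
  -- `β` cannot vanish and the two variables are within `δ`.
  set N : ℝ := f y₁ + k y₁ + η - m + 1 with hN
  have hN0 : 0 < N := by
    have := hm y₁ hy₁
    have := hk0 y₁ hy₁
    linarith
  -- The penalty depends on `p.1 - p.2` only: its derivative in the directions `(v, v)` is zero,
  -- however large `N` and `δ⁻¹` are.
  let P : X × X → ℝ := fun p => N * (1 - β (δ⁻¹ • (p.1 - p.2)))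
  have hP : ContDiff ℝ 1 P := contDiff_const.mul (contDiff_const.sub
    (hβ.contDiff.comp (contDiff_const.smul (contDiff_fst.sub contDiff_snd))))
  have hP0 : ∀ p, 0 ≤ P p := fun p => mul_nonneg hN0.le (sub_nonneg.2 (hβ.le_one _))
  have hPdiag : ∀ y z v : X, ∀ t : ℝ, P ((y, z) + t • (v, v)) = P (y, z) := by
    intro y z v t
    simp [P]
  have hcont : ContinuousOn (fun p : X × X => f p.1 + k p.2 + P p) (S ×ˢ S) :=
    ((hf.comp continuousOn_fst fun p hp => hp.1).add
      (hk.comp continuousOn_snd fun p hp => hp.2)).add hP.continuous.continuousOn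
  obtain ⟨G, hG, hGη, hG', ⟨y, z⟩, ⟨hy, hz⟩, hmin⟩ := (hβ.prod hβ).exists_perturbation_isMinOn
    (hS.prod hS) ⟨(y₁, y₁), hy₁, hy₁⟩ hcont (m := m)
    (fun p hp => by linarith [hm _ hp.1, hk0 _ hp.2, hP0 p]) (half_pos hη)
  simp only at hy hz
  have hP1 : P (y₁, y₁) = 0 := by simp [P, hβ.eventually_eq_one.self_of_nhds]
  have h1 : f y + k z + P (y, z) ≤ f y₁ + k y₁ + η := by
    have h2 := hmin (y₁, y₁) ⟨hy₁, hy₁⟩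
    simp only [hP1] at h2
    have h3 := abs_le.1 (hGη (y, z))
    have h4 := abs_le.1 (hGη (y₁, y₁))
    linarith
  refine ⟨y, hy, z, hz, ?_, by linarith [hP0 (y, z)], fun p => G p - P p, hG.sub hP, ?_, ?_⟩
  · by_contra hlt
    push Not at hlt
    have : β (δ⁻¹ • (y - z)) = 0 := by
      apply hβ.eq_zero
      rw [norm_smul, Real.norm_of_nonneg (by positivity), ← div_eq_inv_mul, le_div_iff₀ hδ]
      linarith
    have : P (y, z) = N := by simp [P, this]
    linarith [hm y hy, hk0 z hz]
  · intro y' hy' z' hz'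
    have := hmin (y', z') ⟨hy', hz'⟩
    simp only at this
    linarith
  · intro v
    have hGd : DifferentiableAt ℝ G (y, z) := hG.differentiable (by norm_num) _
    have hPd : DifferentiableAt ℝ P (y, z) := hP.differentiable (by norm_num) _
    have hPv : fderiv ℝ P (y, z) (v, v) = 0 := by
      rw [← hPd.lineDeriv_eq_fderiv, lineDeriv]
      simp_rw [hPdiag]
      simp
    rw [fderiv_fun_sub hGd hPd]
    have := (fderiv ℝ G (y, z)).le_of_opNorm_le (hG' (y, z)) (v, v)
    rw [sub_apply, hPv, sub_zero, ← Real.norm_eq_abs]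
    refine this.trans ?_
    rw [Prod.norm_mk, max_self]
    have := norm_nonneg v
    nlinarith

/-! ### Growth and cones in the model space. -/

section

variable {X : Type*} [NormedAddCommGroup X] [NormedSpace ℝ X]

theorem Seminorm.continuous_of_le_mul_norm {n : Seminorm ℝ X} {K : ℝ} (hn : ∀ v, n v ≤ K * ‖v‖) :
    Continuous n :=
  Seminorm.continuous_of_le (q := (‖K‖₊) • normSeminorm ℝ X)
    (by
      have : Continuous fun v : X => ‖K‖ * ‖v‖ := by fun_prop
      exact this)
    fun v => (hn v).trans (mul_le_mul_of_nonneg_right (le_abs_self K) (norm_nonneg v))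

theorem fderiv_partial_left {Ψ : X × X → ℝ} (hΨ : ContDiff ℝ 1 Ψ) (y z : X) :
    ∀ v, fderiv ℝ (fun y' => Ψ (y', z)) y v = fderiv ℝ Ψ (y, z) (v, 0) := by
  intro v
  have h1 : HasFDerivAt Ψ (fderiv ℝ Ψ (y, z)) (y, z) :=
    (hΨ.differentiable (by norm_num) _).hasFDerivAt
  have := h1.comp (f := fun y' => (y', z)) y (hasFDerivAt_prodMk_left y z)
  rw [HasFDerivAt.fderiv (f := fun y' => Ψ (y', z)) this]
  rfl

/-- A one-sided bound on the increments in the second variable bounds the partial derivative. -/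
theorem fderiv_snd_le_of_eventually_le {Ψ : X × X → ℝ} (hΨ : ContDiff ℝ 1 Ψ) {y z v : X} {C : ℝ}
    (h : ∀ᶠ s in 𝓝[>] (0 : ℝ), Ψ (y, z + s • v) - Ψ (y, z) ≤ C * s) :
    fderiv ℝ Ψ (y, z) (0, v) ≤ C := by
  have hd : DifferentiableAt ℝ Ψ (y, z) := hΨ.differentiable (by norm_num) _
  have h1 : HasDerivAt (fun s : ℝ => Ψ ((y, z) + s • ((0 : X), v)))
      (fderiv ℝ Ψ (y, z) (0, v)) 0 := hd.hasFDerivAt.hasLineDerivAt _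
  have h2 := (hasDerivAt_iff_tendsto_slope_zero.1 h1).mono_left
    (nhdsWithin_mono 0 (fun s (hs : 0 < s) => hs.ne') : 𝓝[>] (0 : ℝ) ≤ 𝓝[≠] 0)
  refine le_of_tendsto h2 ?_
  filter_upwards [h, self_mem_nhdsWithin] with s hs hs0
  have hs0 : 0 < s := hs0
  simp only [zero_add, smul_eq_mul, zero_smul, add_zero, Prod.smul_mk, smul_zero, Prod.mk_add_mk]
  rw [inv_mul_le_iff₀ hs0]
  linarith

variable [CompleteSpace X]

/-- If `w` lies above a cone of slope `θ₁` with vertex at a point of its graph, then at some nearby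
point it has a subdifferential of norm at most `θ₂`. -/
theorem IsUnitBump.exists_isLocalMin_sub {β : X → ℝ} (hβ : IsUnitBump β) {n : Seminorm ℝ X}
    {K : ℝ} (hK : 0 < K) (hn1 : ∀ v, ‖v‖ ≤ K * n v) (hn2 : ∀ v, n v ≤ K * ‖v‖)
    {w : X → ℝ} {y₀ : X} {ρ : ℝ} (hρ : 0 < ρ)
    (hw : ContinuousOn w (Metric.closedBall y₀ ρ)) {θ₁ θ₂ : ℝ} (hθ₁ : 0 ≤ θ₁) (hθ : θ₁ < θ₂)
    (hmin : ∀ y ∈ Metric.closedBall y₀ ρ, w y₀ - θ₁ * n (y - y₀) ≤ w y) :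
    ∃ y ∈ Metric.ball y₀ ρ, ∃ G : X → ℝ, ContDiff ℝ 1 G ∧ IsLocalMin (fun x => w x - G x) y ∧
      ∀ v, |fderiv ℝ G y v| ≤ θ₂ * n v := by
  set S := Metric.closedBall y₀ ρ
  obtain ⟨θ, hθθ₁, hθθ₂⟩ := exists_between hθ
  have hθ0 : 0 < θ := hθ₁.trans_lt hθθ₁
  have hnc := Seminorm.continuous_of_le_mul_norm hn2
  let k : X → ℝ := fun z => θ * n (z - y₀)
  have hk : Continuous k := by fun_prop
  have hk0 : ∀ z, 0 ≤ k z := fun z => mul_nonneg hθ0.le (apply_nonneg n _)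
  -- The first bound absorbs the error `η * ‖v‖` into `(θ₂ - θ) * n v`. The second, together with
  -- `δ`, keeps `y` within `ρ / 2` of `y₀`: the cone of slope `θ > θ₁` beats the lower bound on `w`.
  set η : ℝ := min ((θ₂ - θ) / K) ((θ - θ₁) * ρ / (4 * K)) with hη
  have hη0 : 0 < η := by
    have : 0 < θ₂ - θ := by linarith
    have : 0 < θ - θ₁ := by linarith
    positivity
  have hη1 : η * K ≤ θ₂ - θ := (le_div_iff₀ hK).1 (min_le_left _ _)
  have hη2 : η * (4 * K) ≤ (θ - θ₁) * ρ := (le_div_iff₀ (by positivity)).1 (min_le_right _ _)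
  set δ : ℝ := min (ρ / 4) ((θ - θ₁) * ρ / (4 * K * (θ * K))) with hδ
  have hδ0 : 0 < δ := by
    have : 0 < θ - θ₁ := by linarith
    positivity
  have hδ1 : δ ≤ ρ / 4 := min_le_left _ _
  have hδ2 : δ * (4 * K * (θ * K)) ≤ (θ - θ₁) * ρ :=
    (le_div_iff₀ (by positivity)).1 (min_le_right _ _)
  have hm : ∀ y ∈ S, w y₀ - θ₁ * (K * ρ) ≤ w y := fun y hy => by
    have h1 := hmin y hy
    have h2 : ‖y - y₀‖ ≤ ρ := mem_closedBall_iff_norm.1 hy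
    have h3 : n (y - y₀) ≤ K * ρ := (hn2 _).trans (mul_le_mul_of_nonneg_left h2 hK.le)
    have := mul_le_mul_of_nonneg_left h3 hθ₁
    linarith
  obtain ⟨y, hy, z, hz, hyz, hle, Ψ, hΨ, hΨmin, hΨd⟩ := hβ.exists_doubled_min
    Metric.isClosed_closedBall hw hk.continuousOn hm (fun z _ => hk0 z)
    (Metric.mem_closedBall_self hρ.le) hη0 hδ0
  have hk00 : k y₀ = 0 := by simp [k]
  have hyn : (θ - θ₁) * n (y - y₀) ≤ η + θ * (K * δ) := by
    have h1 := hmin y hy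
    have h2 : n (y - y₀) ≤ n (z - y₀) + K * δ := by
      have h3 : n (y - z) ≤ K * δ := (hn2 _).trans (mul_le_mul_of_nonneg_left hyz hK.le)
      have h4 := map_add_le_add n (y - z) (z - y₀)
      rw [sub_add_sub_cancel] at h4
      linarith
    have h5 := mul_le_mul_of_nonneg_left h2 hθ0.le
    have h6 : k z = θ * n (z - y₀) := rfl
    nlinarith
  have hyρ : ‖y - y₀‖ ≤ ρ / 2 := by
    have h1 := hn1 (y - y₀)
    have h2 : 0 < θ - θ₁ := by linarith
    have h3 : (θ - θ₁) * (K * n (y - y₀)) ≤ (θ - θ₁) * (ρ / 2) := by nlinarith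
    exact h1.trans (le_of_mul_le_mul_left h3 h2)
  have hzρ : ‖z - y₀‖ < ρ := by
    have := norm_sub_le_norm_sub_add_norm_sub z y y₀
    rw [norm_sub_rev z y] at this
    linarith
  refine ⟨y, mem_ball_iff_norm.2 (by linarith), fun x => Ψ (x, z),
    hΨ.comp (contDiff_id.prodMk contDiff_const), ?_, fun v => ?_⟩
  · filter_upwards [Metric.isOpen_ball.mem_nhds (mem_ball_iff_norm.2 (by linarith : _ < ρ))]
      with x hx
    linarith [hΨmin x (Metric.ball_subset_closedBall hx) z hz]
  -- Minimality in `z` alone: increments of `Ψ (y, ·)` are at most those of `k`, which is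
  -- `θ`-Lipschitz for `n`.
  · have key : ∀ v, fderiv ℝ Ψ (y, z) (0, v) ≤ θ * n v := by
      intro v
      apply fderiv_snd_le_of_eventually_le hΨ
      have hc : Tendsto (fun s : ℝ => z + s • v) (𝓝 0) (𝓝 z) :=
        Continuous.tendsto' (by fun_prop) _ _ (by simp)
      filter_upwards [self_mem_nhdsWithin, nhdsWithin_le_nhds (hc.eventually_mem
        (Metric.isOpen_ball.mem_nhds (mem_ball_iff_norm.2 hzρ)))] with s hs hsz
      have hs : 0 < s := hs
      have h1 := hΨmin y hy _ (Metric.ball_subset_closedBall hsz)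
      have h2 : n (z + s • v - y₀) ≤ n (z - y₀) + s * n v := by
        have := map_add_le_add n (z - y₀) (s • v)
        rw [map_smul_eq_mul, Real.norm_of_nonneg hs.le, sub_add_eq_add_sub] at this
        exact this
      have h3 := mul_le_mul_of_nonneg_left h2 hθ0.le
      simp only [k] at h1
      linarith
    have h1 := key v
    have h2 := key (-v)
    rw [map_neg_eq_map, ← neg_zero, ← Prod.neg_mk, map_neg] at h2
    have e : fderiv ℝ (fun x => Ψ (x, z)) y v
        = fderiv ℝ Ψ (y, z) (v, v) - fderiv ℝ Ψ (y, z) (0, v) := by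
      rw [fderiv_partial_left hΨ, ← map_sub]
      simp
    have h3 := abs_le.1 (hΨd v)
    have h4 : η * ‖v‖ ≤ (θ₂ - θ) * n v := by
      have := mul_le_mul_of_nonneg_left (hn1 v) hη0.le
      have := mul_le_mul_of_nonneg_right hη1 (apply_nonneg n v)
      linarith
    rw [e, abs_le]
    constructor <;> linarith

/-- If all superdifferentials of `w` near `y₀` are bounded by `L₀`, then `w` grows at a rate at most
`L > L₀` around `y₀`. -/
theorem IsUnitBump.eventually_sub_le {β : X → ℝ} (hβ : IsUnitBump β) {n : Seminorm ℝ X}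
    {K : ℝ} (hK : 0 < K) (hn1 : ∀ v, ‖v‖ ≤ K * n v) (hn2 : ∀ v, n v ≤ K * ‖v‖)
    {w : X → ℝ} {O : Set X} (hO : IsOpen O) (hw : ContinuousOn w O) {y₀ : X} (hy₀ : y₀ ∈ O)
    {L₀ L : ℝ} (hL₀ : 0 ≤ L₀) (hL : L₀ < L)
    (hmax : ∀ y ∈ O, ∀ G : X → ℝ, ContDiff ℝ 1 G → IsLocalMax (fun x => w x - G x) y →
      ∀ v, |fderiv ℝ G y v| ≤ L₀ * n v) :
    ∀ᶠ y in 𝓝 y₀, w y - w y₀ ≤ L * n (y - y₀) := by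
  have hnc := Seminorm.continuous_of_le_mul_norm hn2
  have hwc : ContinuousAt w y₀ := hw.continuousAt (hO.mem_nhds hy₀)
  have hosc : ∀ σ > 0, ∀ᶠ y in 𝓝 y₀, |w y - w y₀| < σ := fun σ hσ =>
    hwc.eventually_mem (Metric.ball_mem_nhds _ hσ)
  obtain ⟨ρ, hρ, hρS⟩ := Metric.nhds_basis_closedBall.mem_iff.1
    (inter_mem (hO.mem_nhds hy₀) (hosc 1 one_pos))
  set S := Metric.closedBall y₀ ρ
  obtain ⟨L', hL₀L', hL'L⟩ := exists_between hL
  have hL'0 : 0 < L' := hL₀.trans_lt hL₀L'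
  -- The quadratic term confines the minimum to the interior of the ball: as `w` oscillates by less
  -- than `1`, `k z ≤ 1` will force `2 * K / ρ * n (z - y₀) ≤ 3 / 4`. Near `y₀` it is absorbed by
  -- `(L - L') * n`.
  set A : ℝ := 3 * (2 * K / ρ) ^ 2 with hA
  have hA0 : 0 < A := by positivity
  let k : X → ℝ := fun z => L' * n (z - y₀) + A * n (z - y₀) ^ 2
  have hk : Continuous k := by fun_prop
  have hk0 : ∀ z, 0 ≤ k z := fun z => by
    have := apply_nonneg n (z - y₀)
    positivity
  have hnear : ∀ᶠ y in 𝓝 y₀, A * n (y - y₀) ≤ L - L' := by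
    have : Tendsto (fun y => A * n (y - y₀)) (𝓝 y₀) (𝓝 0) :=
      Continuous.tendsto' (by fun_prop) _ _ (by simp)
    filter_upwards [this.eventually_lt_const (sub_pos.2 hL'L)] with y hy using hy.le
  filter_upwards [hnear, Metric.closedBall_mem_nhds y₀ hρ] with y₁ hy₁ hy₁S
  by_contra! hlt
  set σ : ℝ := w y₁ - k y₁ - w y₀ with hσ
  have hσ0 : 0 < σ := by
    have := mul_le_mul_of_nonneg_right hy₁ (apply_nonneg n (y₁ - y₀))
    simp only [hσ, k]
    linarith
  obtain ⟨δ₀, hδ₀, hδ₀S⟩ := Metric.nhds_basis_closedBall.mem_iff.1 (hosc (σ / 2) (by positivity))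
  set δ : ℝ := min δ₀ (ρ / 4)
  have hδ0 : 0 < δ := by positivity
  set η : ℝ := min (σ / 2) ((L' - L₀) / (2 * K)) with hη
  have hη0 : 0 < η := by
    have : 0 < L' - L₀ := by linarith
    positivity
  have hησ : η ≤ σ / 2 := min_le_left _ _
  have hηK : η * (2 * K) ≤ L' - L₀ := (le_div_iff₀ (by positivity)).1 (min_le_right _ _)
  have hosc1 : ∀ y ∈ S, |w y - w y₀| < 1 := fun y hy => (hρS hy).2
  obtain ⟨y, hy, z, hz, hyz, hle, Ψ, hΨ, hΨmin, hΨd⟩ := hβ.exists_doubled_min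
    (f := fun y => -w y) (m := -w y₀ - 1)
    Metric.isClosed_closedBall (hw.mono fun y hy => (hρS hy).1).neg hk.continuousOn
    (fun y hy => by linarith [(abs_lt.1 (hosc1 y hy)).2]) (fun z _ => hk0 z) hy₁S hη0 hδ0
  have hle' : w y₀ + k z + σ / 2 ≤ w y := by linarith
  have hkz : k z ≤ 1 := by linarith [(abs_lt.1 (hosc1 y hy)).2]
  -- The vertex is where `n` has no slope to exploit. It is excluded because `y` would then be too
  -- close to `y₀` for `w y` to exceed `w y₀` by `σ / 2`.
  have hzy₀ : z ≠ y₀ := by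
    rintro rfl
    have h1 : |w y - w z| < σ / 2 := hδ₀S (mem_closedBall_iff_norm.2
      (hyz.trans (min_le_left _ _)))
    linarith [hk0 z, (abs_lt.1 h1).2]
  have hzρ : ‖z - y₀‖ ≤ ρ / 2 * (3 / 4) := by
    have h0 := apply_nonneg n (z - y₀)
    have h1 : A * n (z - y₀) ^ 2 ≤ 1 := by
      have : 0 ≤ L' * n (z - y₀) := by positivity
      simp only [k] at hkz
      linarith
    have h2 : 3 * (2 * K / ρ * n (z - y₀)) ^ 2 ≤ 1 := by
      rwa [mul_pow, ← mul_assoc, ← hA]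
    have h3 : 2 * K / ρ * n (z - y₀) ≤ 3 / 4 := by
      by_contra! h4
      have : (3 / 4 : ℝ) ^ 2 < (2 * K / ρ * n (z - y₀)) ^ 2 := by gcongr
      norm_num at this
      linarith
    have h4 := hn1 (z - y₀)
    have h5 : K * n (z - y₀) = ρ / 2 * (2 * K / ρ * n (z - y₀)) := by field_simp
    rw [h5] at h4
    exact h4.trans (by gcongr)
  have hyρ : ‖y - y₀‖ < ρ := by
    have := norm_sub_le_norm_sub_add_norm_sub y z y₀
    have := hyz.trans (min_le_right δ₀ (ρ / 4))
    linarith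
  have hyO : y ∈ O := (hρS hy).1
  have hG : ContDiff ℝ 1 fun x => Ψ (x, z) := hΨ.comp (contDiff_id.prodMk contDiff_const)
  have hloc : IsLocalMax (fun x => w x - -Ψ (x, z)) y := by
    filter_upwards [Metric.isOpen_ball.mem_nhds (mem_ball_iff_norm.2 hyρ)] with x hx
    linarith [hΨmin x (Metric.ball_subset_closedBall hx) z hz]
  -- In the direction of the vertex `k` decreases at rate at least `L' * n v`. Transferred to the
  -- `y` variable, this is a superdifferential too large for the bound `L₀`.
  set v : X := y₀ - z with hv
  have hb := hmax y hyO _ hG.neg hloc v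
  have hnv : 0 < n v := by
    have h1 : 0 < ‖v‖ := norm_pos_iff.2 (sub_ne_zero.2 hzy₀.symm)
    have h2 := hn1 v
    by_contra! h3
    linarith [mul_nonpos_of_nonneg_of_nonpos hK.le h3]
  have key : fderiv ℝ Ψ (y, z) (0, v) ≤ -(L' * n v) := by
    apply fderiv_snd_le_of_eventually_le hΨ
    filter_upwards [self_mem_nhdsWithin, Ioc_mem_nhdsGT one_pos] with s hs hs1
    have hs : 0 < s := hs
    have e : z + s • v - y₀ = (1 - s) • (z - y₀) := by
      rw [hv]; module
    have hs2 : 0 ≤ 1 - s := by linarith [hs1.2]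
    have hmem : z + s • v ∈ S := by
      rw [mem_closedBall_iff_norm, e, norm_smul, Real.norm_of_nonneg hs2]
      have := norm_nonneg (z - y₀)
      nlinarith
    have h1 := hΨmin y hy _ hmem
    have hnz : n v = n (z - y₀) := by rw [hv, map_sub_rev]
    simp only [k, e, map_smul_eq_mul, Real.norm_of_nonneg hs2, ← hnz] at h1
    have : A * ((1 - s) * n v) ^ 2 ≤ A * n v ^ 2 := by
      have h0 : 0 ≤ (1 - s) * n v := by positivity
      have h0' : (1 - s) * n v ≤ n v := mul_le_of_le_one_left hnv.le (by linarith)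
      gcongr
    linarith
  have e : fderiv ℝ (fun x => -Ψ (x, z)) y v
      = fderiv ℝ Ψ (y, z) (0, v) - fderiv ℝ Ψ (y, z) (v, v) := by
    rw [fderiv_fun_neg, neg_apply, fderiv_partial_left hΨ, ← map_neg,
      ← map_sub]
    simp
  have h3 := abs_le.1 (hΨd v)
  have h4 : η * ‖v‖ ≤ η * (K * n v) := mul_le_mul_of_nonneg_left (hn1 v) hη0.le
  rw [e] at hb
  have h5 := (abs_le.1 hb).1
  have h6 := mul_le_mul_of_nonneg_right hηK hnv.le
  have h7 : 0 < (L' - L₀) * n v := mul_pos (by linarith) hnv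
  linarith

end

/-! ### Piecewise `C^1` paths. -/

namespace IsPiecewiseC1Path

variable {X M : Type*} [NormedAddCommGroup X] [NormedSpace ℝ X]
  [TopologicalSpace M] [ChartedSpace X M] {c c' : ℝ → M} {a b d : ℝ}

theorem le (h : IsPiecewiseC1Path X c a b) : a ≤ b := by
  obtain ⟨n, t, ht, rfl, rfl, -⟩ := h
  exact ht (Nat.zero_le n)

theorem refl (c : ℝ → M) (a : ℝ) : IsPiecewiseC1Path X c a a :=
  ⟨0, fun _ => a, monotone_const, rfl, rfl, fun i hi => absurd hi (Nat.not_lt_zero i)⟩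

theorem of_contMDiffOn (hab : a ≤ b) (h : ContMDiffOn 𝓘(ℝ, ℝ) 𝓘(ℝ, X) 1 c (Icc a b)) :
    IsPiecewiseC1Path X c a b := by
  refine ⟨1, fun i => if i = 0 then a else b, ?_, by simp, by simp, ?_⟩
  · refine monotone_nat_of_le_succ fun i => ?_
    rcases i with _ | i <;> simp [hab]
  · intro i hi
    obtain rfl : i = 0 := by lia
    simpa using h

theorem trans (h : IsPiecewiseC1Path X c a b) (h' : IsPiecewiseC1Path X c b d) :
    IsPiecewiseC1Path X c a d := by
  obtain ⟨n, t, ht, h0, hn, hc⟩ := h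
  obtain ⟨n', t', ht', h0', hn', hc'⟩ := h'
  have e1 : ∀ i ≤ n, (if i ≤ n then t i else t' (i - n)) = t i := fun i hi => if_pos hi
  have e2 : ∀ i, n ≤ i → (if i ≤ n then t i else t' (i - n)) = t' (i - n) := by
    intro i hi
    split_ifs with h
    · obtain rfl : i = n := le_antisymm h hi
      rw [Nat.sub_self, hn, h0']
    · rfl
  refine ⟨n + n', fun i => if i ≤ n then t i else t' (i - n), ?_, ?_, ?_, ?_⟩
  · refine monotone_nat_of_le_succ fun i => ?_
    rcases Nat.lt_or_ge i n with hi | hi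
    · rw [e1 i hi.le, e1 (i + 1) hi]
      exact ht i.le_succ
    · rw [e2 i hi, e2 (i + 1) (hi.trans i.le_succ)]
      exact ht' (by lia)
  · simpa using h0
  · beta_reduce
    rw [e2 _ (Nat.le_add_right _ _), Nat.add_sub_cancel_left, hn']
  · intro i hi
    rcases Nat.lt_or_ge i n with hin | hin
    · beta_reduce
      rw [e1 i hin.le, e1 (i + 1) hin]
      exact hc i hin
    · beta_reduce
      rw [e2 i hin, e2 (i + 1) (hin.trans i.le_succ), Nat.sub_add_comm hin]
      exact hc' (i - n) (by lia)

-- Pieces reduced to a point are left to the case `refl`, so that in the case `piece` the interval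
-- has nonempty interior and unique derivatives.
@[elab_as_elim]
theorem induction {P : ℝ → ℝ → Prop} (h : IsPiecewiseC1Path X c a b)
    (refl : ∀ s, P s s) (trans : ∀ r s t, r ≤ s → s ≤ t → P r s → P s t → P r t)
    (piece : ∀ s t, s < t → a ≤ s → t ≤ b →
      ContMDiffOn 𝓘(ℝ, ℝ) 𝓘(ℝ, X) 1 c (Icc s t) → P s t) : P a b := by
  obtain ⟨n, t, ht, rfl, rfl, hc⟩ := h
  have : ∀ i ≤ n, P (t 0) (t i) := by
    intro i
    induction i with
    | zero => exact fun _ => refl _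
    | succ i ih =>
      intro hi
      refine trans _ _ _ (ht i.zero_le) (ht i.le_succ) (ih (by lia)) ?_
      rcases (ht i.le_succ).eq_or_lt with h | h
      · rw [← h]
        exact refl _
      · exact piece _ _ h (ht i.zero_le) (ht hi) (hc i hi)
  exact this n le_rfl

theorem mono (h : IsPiecewiseC1Path X c a b) {s t : ℝ} (has : a ≤ s) (hst : s ≤ t) (htb : t ≤ b) :
    IsPiecewiseC1Path X c s t := by
  refine h.induction (P := fun a b => ∀ s t, a ≤ s → s ≤ t → t ≤ b → IsPiecewiseC1Path X c s t)
    ?_ ?_ ?_ s t has hst htb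
  · intro r s t h1 h2 h3
    obtain rfl : s = t := by linarith
    exact refl _ _
  · intro r m l hrm hml h1 h2 s t hs hst ht
    rcases le_total t m with htm | htm
    · exact h1 s t hs hst htm
    · rcases le_total m s with hms | hms
      · exact h2 s t hms hst ht
      · exact (h1 s m hs hms le_rfl).trans (h2 m t le_rfl htm ht)
  · intro r l _ _ _ hc s t hs hst ht
    exact of_contMDiffOn hst (hc.mono (Icc_subset_Icc hs ht))

theorem continuousOn (h : IsPiecewiseC1Path X c a b) : ContinuousOn c (Icc a b) := by
  refine h.induction (P := fun a b => ContinuousOn c (Icc a b)) ?_ ?_ ?_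
  · intro s
    rw [Icc_self]
    exact continuousOn_singleton _ _
  · intro r s t hrs hst h1 h2
    rw [← Icc_union_Icc_eq_Icc hrs hst]
    exact h1.union_of_isClosed h2 isClosed_Icc isClosed_Icc
  · intro s t _ _ _ hc
    exact hc.continuousOn

theorem congr (h : IsPiecewiseC1Path X c a b) (hcc' : EqOn c' c (Icc a b)) :
    IsPiecewiseC1Path X c' a b := by
  obtain ⟨n, t, ht, rfl, rfl, hc⟩ := h
  refine ⟨n, t, ht, rfl, rfl, fun i hi => (hc i hi).congr ?_⟩
  exact hcc'.mono (Icc_subset_Icc (ht i.zero_le) (ht hi))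

theorem comp_neg (h : IsPiecewiseC1Path X c a b) :
    IsPiecewiseC1Path X (fun t => c (-t)) (-b) (-a) := by
  refine h.induction (P := fun a b => IsPiecewiseC1Path X (fun t => c (-t)) (-b) (-a)) ?_ ?_ ?_
  · exact fun s => refl _ _
  · exact fun r s t _ _ h1 h2 => h2.trans h1
  · intro s t hst _ _ hc
    refine of_contMDiffOn (by linarith) (hc.comp contDiff_neg.contMDiff.contMDiffOn ?_)
    intro r hr
    exact ⟨by linarith [hr.2], by linarith [hr.1]⟩

theorem comp_add_right (h : IsPiecewiseC1Path X c a b) (τ : ℝ) :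
    IsPiecewiseC1Path X (fun t => c (t + τ)) (a - τ) (b - τ) := by
  refine h.induction
    (P := fun a b => IsPiecewiseC1Path X (fun t => c (t + τ)) (a - τ) (b - τ)) ?_ ?_ ?_
  · exact fun s => refl _ _
  · exact fun r s t _ _ h1 h2 => h1.trans h2
  · intro s t hst _ _ hc
    refine of_contMDiffOn (by linarith)
      (hc.comp (contDiff_id.add contDiff_const).contMDiff.contMDiffOn ?_)
    intro r hr
    simp only [mem_preimage, mem_Icc] at hr ⊢
    constructor <;> linarith [hr.1, hr.2]

end IsPiecewiseC1Path

/-! ### Length of paths and the Finsler distance. -/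

namespace PalaisFinsler

variable {X M : Type*} [NormedAddCommGroup X] [NormedSpace ℝ X]
  [TopologicalSpace M] [ChartedSpace X M] [IsManifold 𝓘(ℝ, X) 1 M] (F : PalaisFinsler X M)
  {c c' : ℝ → M} {a b d : ℝ}

/-- The norm of the velocity of a path. -/
noncomputable def speed (c : ℝ → M) (t : ℝ) : ℝ := F.nrm (c t) (mfderiv 𝓘(ℝ, ℝ) 𝓘(ℝ, X) c t (1 : ℝ))

theorem speed_nonneg (c : ℝ → M) (t : ℝ) : 0 ≤ F.speed c t := apply_nonneg _ _

/-- The norm at `p`, as a function on the model space. -/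
noncomputable def modelNrm (p : M) (v : X) : ℝ := F.nrm p v

theorem pathLength_eq (c : ℝ → M) (a b : ℝ) : F.pathLength c a b = ∫ t in a..b, F.speed c t := rfl

theorem speed_congr {t : ℝ} (h : c =ᶠ[𝓝 t] c') : F.speed c t = F.speed c' t := by
  have h1 : c t = c' t := h.eq_of_nhds
  have h2 : (mfderiv 𝓘(ℝ, ℝ) 𝓘(ℝ, X) c t : ℝ →L[ℝ] X) = mfderiv 𝓘(ℝ, ℝ) 𝓘(ℝ, X) c' t :=
    h.mfderiv_eq
  -- Every tangent space is definitionally `X`; in terms of `modelNrm` the base point can be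
  -- rewritten without dependent types.
  change F.modelNrm (c t) ((mfderiv 𝓘(ℝ, ℝ) 𝓘(ℝ, X) c t : ℝ →L[ℝ] X) 1)
    = F.modelNrm (c' t) ((mfderiv 𝓘(ℝ, ℝ) 𝓘(ℝ, X) c' t : ℝ →L[ℝ] X) 1)
  rw [h1, h2]

theorem pathLength_congr (hab : a ≤ b) (h : EqOn c c' (Icc a b)) :
    F.pathLength c a b = F.pathLength c' a b := by
  refine intervalIntegral.integral_congr_Ioo_of_le hab fun t ht => ?_
  apply F.speed_congr
  filter_upwards [Icc_mem_nhds ht.1 ht.2] with s hs using h hs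

variable {F} in
theorem modelNrm_smul (p : M) (σ : ℝ) (v : X) : F.modelNrm p (σ • v) = |σ| * F.modelNrm p v :=
  map_smul_eq_mul (F.nrm p) σ (v : TangentSpace 𝓘(ℝ, X) p)

variable {F} in
theorem speed_of_hasMFDerivAt {t : ℝ} {D : ℝ →L[ℝ] X}
    (h : HasMFDerivAt 𝓘(ℝ, ℝ) 𝓘(ℝ, X) c t D) : F.speed c t = F.modelNrm (c t) (D 1) := by
  have h1 : (mfderiv 𝓘(ℝ, ℝ) 𝓘(ℝ, X) c t : ℝ →L[ℝ] X) = D := h.mfderiv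
  exact congrArg (fun D : ℝ →L[ℝ] X => F.modelNrm (c t) (D 1)) h1

theorem speed_comp_affine (c : ℝ → M) {σ : ℝ} (hσ : |σ| = 1) (τ t : ℝ) :
    F.speed (fun t => c (σ * t + τ)) t = F.speed c (σ * t + τ) := by
  have key : ∀ (c : ℝ → M) (σ τ t : ℝ) (D : ℝ →L[ℝ] X),
      HasMFDerivAt 𝓘(ℝ, ℝ) 𝓘(ℝ, X) c (σ * t + τ) D →
      HasMFDerivAt 𝓘(ℝ, ℝ) 𝓘(ℝ, X) (fun t => c (σ * t + τ)) t
        (D.comp (ContinuousLinearMap.toSpanSingleton ℝ σ)) := by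
    intro c σ τ t D h
    have h1 : HasDerivAt (fun t : ℝ => σ * t + τ) σ t := by
      simpa using ((hasDerivAt_id t).const_mul σ).add_const τ
    exact HasMFDerivAt.comp (f := fun t : ℝ => σ * t + τ) t h h1.hasFDerivAt.hasMFDerivAt
  have hσ2 : σ * σ = 1 := by rw [← abs_mul_abs_self, hσ, one_mul]
  by_cases h : MDifferentiableAt 𝓘(ℝ, ℝ) 𝓘(ℝ, X) c (σ * t + τ)
  · obtain ⟨D, hD⟩ : ∃ D : ℝ →L[ℝ] X, HasMFDerivAt 𝓘(ℝ, ℝ) 𝓘(ℝ, X) c (σ * t + τ) D :=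
      ⟨_, h.hasMFDerivAt⟩
    have h2 : (D.comp (ContinuousLinearMap.toSpanSingleton ℝ σ)) 1 = σ • D 1 := by
      rw [ContinuousLinearMap.comp_apply, ContinuousLinearMap.toSpanSingleton_apply, one_smul,
        ← map_smul, smul_eq_mul, mul_one]
    rw [speed_of_hasMFDerivAt hD]
    refine (speed_of_hasMFDerivAt (key c σ τ t D hD)).trans ?_
    refine (congrArg (F.modelNrm _) h2).trans ?_
    rw [modelNrm_smul, hσ, one_mul]
  -- Where `c` is not differentiable both velocities take the default value `0`. The chain rule for
  -- the inverse affine map shows that the reparametrized path is not differentiable either.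
  · have h' : ¬ MDifferentiableAt 𝓘(ℝ, ℝ) 𝓘(ℝ, X) (fun t => c (σ * t + τ)) t := by
      intro h'
      apply h
      have e : σ * (σ * t + τ) + -(σ * τ) = t := by linear_combination t * hσ2
      have := (key (fun t => c (σ * t + τ)) σ (-(σ * τ)) (σ * t + τ) _
        (by rw [e]; exact h'.hasMFDerivAt)).mdifferentiableAt
      refine this.congr_of_eventuallyEq (Eventually.of_forall fun s => ?_)
      have e' : σ * (σ * s + -(σ * τ)) + τ = s := by linear_combination (s - τ) * hσ2
      simp only [e']
    rw [speed, speed, mfderiv_zero_of_not_mdifferentiableAt h,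
      mfderiv_zero_of_not_mdifferentiableAt h']
    exact (map_zero (F.nrm _)).trans (map_zero (F.nrm _)).symm

theorem pathLength_comp_neg (c : ℝ → M) (a b : ℝ) :
    F.pathLength (fun t => c (-t)) (-b) (-a) = F.pathLength c a b := by
  rw [pathLength_eq, pathLength_eq]
  have : ∀ t, F.speed (fun t => c (-t)) t = F.speed c (-t) := fun t => by
    have := F.speed_comp_affine c (σ := -1) (by simp) 0 t
    simpa using this
  simp_rw [this]
  rw [intervalIntegral.integral_comp_neg (fun t => F.speed c t), neg_neg, neg_neg]

theorem pathLength_comp_add_right (c : ℝ → M) (a b τ : ℝ) :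
    F.pathLength (fun t => c (t + τ)) (a - τ) (b - τ) = F.pathLength c a b := by
  rw [pathLength_eq, pathLength_eq]
  have : ∀ t, F.speed (fun t => c (t + τ)) t = F.speed c (t + τ) := fun t => by
    have := F.speed_comp_affine c (σ := 1) (by simp) τ t
    simpa using this
  simp_rw [this]
  rw [intervalIntegral.integral_comp_add_right (fun t => F.speed c t)]
  simp

variable {F} in
theorem _root_.IsPiecewiseC1Path.intervalIntegrable_speed (h : IsPiecewiseC1Path X c a b) :
    IntervalIntegrable (F.speed c) MeasureTheory.volume a b := by
  refine h.induction (P := fun a b => IntervalIntegrable (F.speed c) MeasureTheory.volume a b)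
    ?_ ?_ ?_
  · exact fun s => IntervalIntegrable.refl
  · exact fun r s t _ _ h1 h2 => h1.trans h2
  · intro s t hst _ _ hc
    -- The norm of the derivative within the closed interval is continuous there, and it agrees with
    -- the speed in the interior.
    have h1 := hc.continuousOn_tangentMapWithin le_rfl
      (uniqueDiffOn_Icc hst).uniqueMDiffOn
    have h2 : Continuous fun r : ℝ => (⟨r, (1 : ℝ)⟩ : TangentBundle 𝓘(ℝ, ℝ) ℝ) :=
      (tangentBundleModelSpaceHomeomorph 𝓘(ℝ, ℝ)).symm.continuous.comp
        (f := fun r : ℝ => ((r, 1) : ModelProd ℝ ℝ)) (by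
          exact (continuous_id.prodMk continuous_const))
    have h3 : ContinuousOn (fun r => F.nrm (c r)
        (mfderivWithin 𝓘(ℝ, ℝ) 𝓘(ℝ, X) c (Icc s t) r (1 : ℝ))) (Icc s t) :=
      F.continuous_nrm.comp_continuousOn (h1.comp h2.continuousOn fun r hr => hr)
    rw [← uIcc_of_le hst.le] at h3
    refine h3.intervalIntegrable.congr_uIoo fun r hr => ?_
    rw [uIoo_of_le hst.le] at hr
    rw [uIcc_of_le hst.le]
    simp only [speed]
    rw [mfderivWithin_of_mem_nhds (Icc_mem_nhds hr.1 hr.2)]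

theorem pathLength_nonneg (hab : a ≤ b) : 0 ≤ F.pathLength c a b :=
  intervalIntegral.integral_nonneg hab fun t _ => F.speed_nonneg c t

variable {F} in
theorem _root_.IsPiecewiseC1Path.pathLength_add (h : IsPiecewiseC1Path X c a b)
    (h' : IsPiecewiseC1Path X c b d) :
    F.pathLength c a b + F.pathLength c b d = F.pathLength c a d :=
  intervalIntegral.integral_add_adjacent_intervals h.intervalIntegrable_speed
    h'.intervalIntegrable_speed

/-- The set of the lengths of the piecewise `C^1` paths from `p` to `q`. -/
def lengths (p q : M) : Set ℝ :=
  {r | ∃ (c : ℝ → M) (a b : ℝ), a ≤ b ∧ IsPiecewiseC1Path X c a b ∧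
    c a = p ∧ c b = q ∧ F.pathLength c a b = r}

theorem fdist_eq (p q : M) : F.fdist p q = sInf (F.lengths p q) := rfl

variable {F} {p q m : M} {r r' : ℝ}

theorem nonneg_of_mem_lengths (h : r ∈ F.lengths p q) : 0 ≤ r := by
  obtain ⟨c, a, b, hab, -, -, -, rfl⟩ := h
  exact F.pathLength_nonneg hab

theorem bddBelow_lengths : BddBelow (F.lengths p q) := ⟨0, fun _ h => nonneg_of_mem_lengths h⟩

theorem zero_mem_lengths (F : PalaisFinsler X M) (p : M) : (0 : ℝ) ∈ F.lengths p p :=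
  ⟨fun _ => p, 0, 0, le_rfl, .refl _ _, rfl, rfl, by simp [pathLength]⟩

theorem lengths_symm (h : r ∈ F.lengths p q) : r ∈ F.lengths q p := by
  obtain ⟨c, a, b, hab, hc, rfl, rfl, rfl⟩ := h
  exact ⟨fun t => c (-t), -b, -a, by linarith, hc.comp_neg, by simp, by simp,
    F.pathLength_comp_neg c a b⟩

theorem add_mem_lengths (h : r ∈ F.lengths p q) (h' : r' ∈ F.lengths q m) :
    r + r' ∈ F.lengths p m := by
  obtain ⟨c, a, b, hab, hc, rfl, rfl, rfl⟩ := h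
  obtain ⟨c', a', b', hab', hc', hq, rfl, rfl⟩ := h'
  have hs := hc'.comp_add_right (a' - b)
  have hl := F.pathLength_comp_add_right c' a' b' (a' - b)
  set c₁ : ℝ → M := fun t => c' (t + (a' - b)) with hc₁
  rw [sub_sub_cancel] at hs hl
  set e := b' - (a' - b) with he
  have hbe : b ≤ e := by linarith
  let c₂ : ℝ → M := fun t => if t ≤ b then c t else c₁ t
  have e1 : EqOn c₂ c (Icc a b) := fun t ht => if_pos ht.2
  have e2 : EqOn c₂ c₁ (Icc b e) := by
    intro t ht
    rcases ht.1.eq_or_lt with rfl | hlt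
    · simp [c₂, hc₁, hq]
    · exact if_neg hlt.not_ge
  have p1 := hc.congr e1
  have p2 := hs.congr e2
  refine ⟨c₂, a, e, hab.trans hbe, p1.trans p2, e1 ⟨le_rfl, hab⟩, ?_, ?_⟩
  · rw [e2 ⟨hbe, le_rfl⟩]
    simp [hc₁, he]
  · rw [← p1.pathLength_add p2, F.pathLength_congr hab e1, F.pathLength_congr hbe e2, hl]

theorem fdist_nonneg : 0 ≤ F.fdist p q := Real.sInf_nonneg fun _ h => nonneg_of_mem_lengths h

theorem fdist_le_of_mem (h : r ∈ F.lengths p q) : F.fdist p q ≤ r := csInf_le bddBelow_lengths h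

variable (F) in
theorem fdist_self (p : M) : F.fdist p p = 0 :=
  le_antisymm (fdist_le_of_mem (F.zero_mem_lengths p)) fdist_nonneg

variable (F) in
theorem fdist_comm (p q : M) : F.fdist p q = F.fdist q p := by
  rw [fdist_eq, fdist_eq]
  congr 1
  ext r
  exact ⟨lengths_symm, lengths_symm⟩

end PalaisFinsler

/-! ### Lengths of paths in charts. -/

namespace PalaisFinsler

variable {X M : Type*} [NormedAddCommGroup X] [NormedSpace ℝ X]
  [TopologicalSpace M] [ChartedSpace X M] {e : OpenPartialHomeomorph M X}

theorem mdifferentiable_of_mem_maximalAtlas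
    (he : e ∈ IsManifold.maximalAtlas 𝓘(ℝ, X) 1 M) : e.MDifferentiable 𝓘(ℝ, X) 𝓘(ℝ, X) :=
  ⟨(contMDiffOn_of_mem_maximalAtlas he).mdifferentiableOn one_ne_zero,
    (contMDiffOn_symm_of_mem_maximalAtlas he).mdifferentiableOn one_ne_zero⟩

variable [IsManifold 𝓘(ℝ, X) 1 M] {F : PalaisFinsler X M} {c : ℝ → M} {a b : ℝ}

/-- The function `chartNorm` at a fixed point, as a seminorm. -/
noncomputable def chartSeminorm (F : PalaisFinsler X M) (e : OpenPartialHomeomorph M X) (y : X) :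
    Seminorm ℝ X :=
  Seminorm.of (chartNorm F.nrm e y)
    (fun v w => by
      unfold chartNorm
      exact (congrArg (F.nrm (e.symm y))
        (map_add (mfderiv 𝓘(ℝ, X) 𝓘(ℝ, X) e.symm y) v w)).trans_le (map_add_le_add _ _ _))
    (fun s v => by
      unfold chartNorm
      exact (congrArg (F.nrm (e.symm y))
        (map_smul (mfderiv 𝓘(ℝ, X) 𝓘(ℝ, X) e.symm y) s v)).trans (map_smul_eq_mul _ _ _))

theorem chartSeminorm_apply (y v : X) : F.chartSeminorm e y v = chartNorm F.nrm e y v := rfl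

theorem chartNorm_mfderiv (he : e ∈ IsManifold.maximalAtlas 𝓘(ℝ, X) 1 M) {p : M}
    (hp : p ∈ e.source) {D : X →L[ℝ] X} (hD : HasMFDerivAt 𝓘(ℝ, X) 𝓘(ℝ, X) e p D) (w : X) :
    chartNorm F.nrm e (e p) (D w) = F.modelNrm p w := by
  have h1 : (mfderiv 𝓘(ℝ, X) 𝓘(ℝ, X) e p : X →L[ℝ] X) = D := hD.mfderiv
  subst h1
  have h2 := (mdifferentiable_of_mem_maximalAtlas he).symm_comp_deriv hp
  have h3 : (mfderiv 𝓘(ℝ, X) 𝓘(ℝ, X) e.symm (e p) : X →L[ℝ] X)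
      ((mfderiv 𝓘(ℝ, X) 𝓘(ℝ, X) e p : X →L[ℝ] X) w) = w :=
    congrArg (fun E : X →L[ℝ] X => E w) h2
  change F.modelNrm (e.symm (e p)) ((mfderiv 𝓘(ℝ, X) 𝓘(ℝ, X) e.symm (e p) : X →L[ℝ] X)
      ((mfderiv 𝓘(ℝ, X) 𝓘(ℝ, X) e p : X →L[ℝ] X) w)) = _
  rw [h3, e.left_inv hp]

theorem pathLength_mono (h : IsPiecewiseC1Path X c a b) {s t : ℝ} (has : a ≤ s) (hst : s ≤ t)
    (htb : t ≤ b) : F.pathLength c s t ≤ F.pathLength c a b := by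
  have h1 := (h.mono le_rfl has (hst.trans htb)).pathLength_add (F := F) (h.mono has hst htb)
  have h2 := (h.mono le_rfl (has.trans hst) htb).pathLength_add (F := F)
    (h.mono (has.trans hst) htb le_rfl)
  have h3 := F.pathLength_nonneg (c := c) has
  have h4 := F.pathLength_nonneg (c := c) htb
  linarith

/-- In a chart, the length of a path bounds the distance of its endpoints. -/
theorem sub_le_pathLength (he : e ∈ IsManifold.maximalAtlas 𝓘(ℝ, X) 1 M) {n : Seminorm ℝ X}
    {K : ℝ} (hn : ∀ v, n v ≤ K * ‖v‖) {C : ℝ} (hc : IsPiecewiseC1Path X c a b)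
    (hcW : ∀ t ∈ Icc a b, c t ∈ e.source ∧ ∀ v, n v ≤ C * chartNorm F.nrm e (e (c t)) v) :
    n (e (c b) - e (c a)) ≤ C * F.pathLength c a b := by
  set v₀ := e (c b) - e (c a) with hv₀
  -- A Hahn–Banach functional norming the displacement reduces the estimate to the fundamental
  -- theorem of calculus for a real function.
  obtain ⟨g, hg, hgn⟩ : ∃ g : X →L[ℝ] ℝ, g v₀ = n v₀ ∧ ∀ v, g v ≤ n v := by
    obtain ⟨g, hg, hgn⟩ : ∃ g : X →ₗ[ℝ] ℝ, g v₀ = n v₀ ∧ ∀ v, g v ≤ n v := by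
      by_cases h0 : v₀ = 0
      · exact ⟨0, by simp [h0], fun v => apply_nonneg n v⟩
      · obtain ⟨g, hg, hgn⟩ := exists_extension_of_le_sublinear
          (LinearPMap.mkSpanSingleton (K := ℝ) v₀ (n v₀) h0) n
          (fun s hs v => by rw [map_smul_eq_mul, Real.norm_of_nonneg hs.le])
          (fun v w => map_add_le_add n v w) (by
            rintro ⟨x, hx⟩
            obtain ⟨s, rfl⟩ := Submodule.mem_span_singleton.1 hx
            refine (LinearPMap.mkSpanSingleton'_apply _ _ _ s hx).trans_le ?_
            rw [RingHom.id_apply, smul_eq_mul, map_smul_eq_mul]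
            exact mul_le_mul_of_nonneg_right (le_abs_self s) (apply_nonneg n v₀))
        exact ⟨g, (hg ⟨v₀, Submodule.mem_span_singleton_self v₀⟩).trans
          (LinearPMap.mkSpanSingleton_apply ℝ ℝ h0 _), hgn⟩
    exact ⟨g.mkContinuous K fun v => (n.abs_le_of_le hgn v).trans (hn v), hg, hgn⟩
  have key : g (e (c b)) - g (e (c a)) ≤ C * F.pathLength c a b := by
    refine hc.induction (P := fun s t => a ≤ s → t ≤ b →
      g (e (c t)) - g (e (c s)) ≤ C * F.pathLength c s t) ?_ ?_ ?_ le_rfl le_rfl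
    · intro s _ _
      simp [pathLength]
    · intro r s t hrs hst h1 h2 har htb
      rw [← (hc.mono har hrs (hst.trans htb)).pathLength_add
        (hc.mono (har.trans hrs) hst htb), mul_add]
      linarith [h1 har (hst.trans htb), h2 (har.trans hrs) htb]
    · intro s t hst has htb hcs _ _
      have hsub : Icc s t ⊆ Icc a b := Icc_subset_Icc has htb
      have hint := (hc.mono has hst.le htb).intervalIntegrable_speed (F := F)
      rw [pathLength_eq, ← intervalIntegral.integral_const_mul]
      refine intervalIntegral.sub_le_integral_of_hasDeriv_right_of_le
        (g := fun r => g (e (c r))) (g' := fun r => deriv (fun r => g (e (c r))) r) hst.le ?_ ?_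
        ((intervalIntegrable_iff_integrableOn_Icc_of_le hst.le).1 (hint.const_mul C)) ?_
      · exact g.continuous.comp_continuousOn (e.continuousOn.comp
          (hc.continuousOn.mono hsub) fun r hr => (hcW r (hsub hr)).1)
      all_goals
        intro r hr
        have hr' : r ∈ Icc a b := hsub ⟨hr.1.le, hr.2.le⟩
        obtain ⟨D, hD⟩ : ∃ D : ℝ →L[ℝ] X, HasMFDerivAt 𝓘(ℝ, ℝ) 𝓘(ℝ, X) c r D :=
          ⟨_, ((hcs.contMDiffAt (Icc_mem_nhds hr.1 hr.2)).mdifferentiableAt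
            one_ne_zero).hasMFDerivAt⟩
        obtain ⟨E, hE⟩ : ∃ E : X →L[ℝ] X, HasMFDerivAt 𝓘(ℝ, X) 𝓘(ℝ, X) e (c r) E :=
          ⟨_, ((mdifferentiable_of_mem_maximalAtlas he).mdifferentiableAt
            (hcW r hr').1).hasMFDerivAt⟩
        have h1 : HasFDerivAt (fun r => e (c r)) (E.comp D) r :=
          hasMFDerivAt_iff_hasFDerivAt.1 (HasMFDerivAt.comp r hE hD)
        have h2 : HasDerivAt (fun r => g (e (c r))) (g (E (D 1))) r :=
          (g.hasFDerivAt.comp r h1).hasDerivAt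
        rw [h2.deriv]
      · exact h2.hasDerivWithinAt
      · calc g (E (D 1)) ≤ n (E (D 1)) := hgn _
          _ ≤ C * chartNorm F.nrm e (e (c r)) (E (D 1)) := (hcW r hr').2 _
          _ = C * F.speed c r := by
            rw [chartNorm_mfderiv he (hcW r hr').1 hE, speed_of_hasMFDerivAt hD]
  rw [← hg, hv₀, map_sub]
  exact key

/-- Line segments in a chart give an upper bound on the distance. -/
theorem exists_mem_lengths_le (he : e ∈ IsManifold.maximalAtlas 𝓘(ℝ, X) 1 M) {n : Seminorm ℝ X}
    {C : ℝ} {y z : X} (hyz : ∀ w ∈ segment ℝ y z, w ∈ e.target ∧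
      ∀ v, chartNorm F.nrm e w v ≤ C * n v) :
    ∃ r ∈ F.lengths (e.symm y) (e.symm z), r ≤ C * n (z - y) := by
  have hseg : ∀ t ∈ Icc (0 : ℝ) 1, y + t • (z - y) ∈ segment ℝ y z := fun t ht => by
    rw [segment_eq_image']
    exact ⟨t, ht, rfl⟩
  set c : ℝ → M := fun t => e.symm (y + t • (z - y)) with hc
  have hcd : ContMDiffOn 𝓘(ℝ, ℝ) 𝓘(ℝ, X) 1 c (Icc 0 1) :=
    (contMDiffOn_symm_of_mem_maximalAtlas he).comp
      (ContDiff.contMDiff (f := fun t : ℝ => y + t • (z - y)) (by fun_prop)).contMDiffOn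
      fun t ht => (hyz _ (hseg t ht)).1
  have hp := IsPiecewiseC1Path.of_contMDiffOn (zero_le_one' ℝ) hcd
  refine ⟨_, ⟨c, 0, 1, zero_le_one, hp, by simp [hc], by simp [hc], rfl⟩, ?_⟩
  have : ∀ t ∈ Ioo (0 : ℝ) 1, F.speed c t ≤ C * n (z - y) := by
    intro t ht
    obtain ⟨hw, hwC⟩ := hyz _ (hseg t ⟨ht.1.le, ht.2.le⟩)
    have h1 : HasDerivAt (fun t : ℝ => y + t • (z - y)) (z - y) t := by
      simpa using ((hasDerivAt_id t).smul_const (z - y)).const_add y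
    have h2 := ((mdifferentiable_of_mem_maximalAtlas he).mdifferentiableAt_symm hw).hasMFDerivAt
    have h3 : HasMFDerivAt 𝓘(ℝ, ℝ) 𝓘(ℝ, X) c t
        ((mfderiv 𝓘(ℝ, X) 𝓘(ℝ, X) e.symm (y + t • (z - y)) : X →L[ℝ] X).comp
          (ContinuousLinearMap.toSpanSingleton ℝ (z - y))) :=
      HasMFDerivAt.comp (f := fun t : ℝ => y + t • (z - y)) t h2 h1.hasFDerivAt.hasMFDerivAt
    rw [speed_of_hasMFDerivAt h3]
    refine le_trans (le_of_eq ?_) (hwC (z - y))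
    refine congrArg (F.modelNrm (c t)) ?_
    exact congrArg (mfderiv 𝓘(ℝ, X) 𝓘(ℝ, X) e.symm (y + t • (z - y)) : X →L[ℝ] X)
      (one_smul ℝ (z - y))
  have h := intervalIntegral.integral_mono_on_of_le_Ioo (zero_le_one' ℝ)
    (hp.intervalIntegrable_speed (F := F)) (intervalIntegrable_const (c := C * n (z - y))) this
  simpa [pathLength_eq] using h

theorem exists_equivalent (F : PalaisFinsler X M) (he : e ∈ IsManifold.maximalAtlas 𝓘(ℝ, X) 1 M)
    {x₀ : M} (hx₀ : x₀ ∈ e.source) : ∃ K : ℝ, 0 < K ∧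
      (∀ v, ‖v‖ ≤ K * F.chartSeminorm e (e x₀) v) ∧ ∀ v, F.chartSeminorm e (e x₀) v ≤ K * ‖v‖ := by
  obtain ⟨K, hK, h⟩ := F.equivalent e he x₀ hx₀
  refine ⟨K, hK, fun v => ?_, fun v => (h v).2⟩
  have := (h v).1
  rwa [inv_mul_le_iff₀ hK] at this

/-- Balls of `X` need not be compact, so their preimages are not closed in `M` for free; here this
comes from a closed neighborhood of `x₀` inside the chart domain. It prevents a path from leaving
the domain without its coordinates leaving the ball. -/
theorem exists_chart_ball (F : PalaisFinsler X M) [RegularSpace M]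
    (he : e ∈ IsManifold.maximalAtlas 𝓘(ℝ, X) 1 M) {x₀ : M} (hx₀ : x₀ ∈ e.source) {ε : ℝ}
    (hε : 0 < ε) {U : Set M} (hU : U ∈ 𝓝 x₀) :
    ∃ R > 0, (∀ y, F.chartSeminorm e (e x₀) (y - e x₀) ≤ R → y ∈ e.target ∧ e.symm y ∈ U ∧
      ∀ v, F.chartSeminorm e (e x₀) v ≤ (1 + ε) * chartNorm F.nrm e y v ∧
        chartNorm F.nrm e y v ≤ (1 + ε) * F.chartSeminorm e (e x₀) v) ∧
      ∀ r ≤ R, IsClosed {p | p ∈ e.source ∧ F.chartSeminorm e (e x₀) (e p - e x₀) ≤ r} := by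
  obtain ⟨K, hK, hn1, hn2⟩ := F.exists_equivalent he hx₀
  obtain ⟨W, hWo, hxW, hWs, hW⟩ := F.palais e he x₀ hx₀ ε hε
  obtain ⟨C, hC, hCc, hCs⟩ := exists_mem_nhds_isClosed_subset (e.open_source.mem_nhds hx₀)
  set n := F.chartSeminorm e (e x₀) with hn
  have hnc := Seminorm.continuous_of_le_mul_norm hn2
  have hy₀ := e.map_source hx₀
  have hnh : e.target ∩ e.symm ⁻¹' (U ∩ W ∩ C) ∈ 𝓝 (e x₀) := by
    refine inter_mem (e.open_target.mem_nhds hy₀) (e.continuousAt_symm hy₀ ?_)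
    rw [e.left_inv hx₀]
    exact inter_mem (inter_mem hU (hWo.mem_nhds hxW)) hC
  obtain ⟨δ, hδ, hδs⟩ := Metric.nhds_basis_closedBall.mem_iff.1 hnh
  have hball : ∀ y, n (y - e x₀) ≤ δ / K → y ∈ e.target ∩ e.symm ⁻¹' (U ∩ W ∩ C) := by
    intro y hy
    refine hδs (mem_closedBall_iff_norm.2 ((hn1 _).trans ?_))
    rw [le_div_iff₀ hK] at hy
    linarith
  refine ⟨δ / K, by positivity, fun y hy => ?_, fun r hr => ?_⟩
  · obtain ⟨h1, ⟨h2, h3⟩, -⟩ := hball y hy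
    refine ⟨h1, h2, fun v => ?_⟩
    obtain ⟨h4, h5⟩ := hW _ h3 v
    rw [e.right_inv h1] at h4 h5
    refine ⟨?_, h5⟩
    rwa [inv_mul_le_iff₀ (by linarith)] at h4
  · have : {p | p ∈ e.source ∧ n (e p - e x₀) ≤ r} = C ∩ e ⁻¹' {y | n (y - e x₀) ≤ r} := by
      ext p
      constructor
      · rintro ⟨hp, hpr⟩
        have := (hball (e p) (hpr.trans hr)).2.2
        rw [e.left_inv hp] at this
        exact ⟨this, hpr⟩
      · rintro ⟨hp, hpr⟩
        exact ⟨hCs hp, hpr⟩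
    rw [this]
    exact (e.continuousOn.mono hCs).preimage_isClosed_of_isClosed hCc
      (isClosed_le (by fun_prop) continuous_const)

theorem exists_first_exit {Y : Type*} [TopologicalSpace Y] {c : ℝ → Y} {a b : ℝ}
    (hc : ContinuousOn c (Icc a b)) {V : Set Y} (hV : IsOpen V) (ha : c a ∈ V)
    (hall : ¬ ∀ t ∈ Icc a b, c t ∈ V) :
    ∃ t₁ ∈ Ioc a b, c t₁ ∉ V ∧ ∀ t ∈ Ico a t₁, c t ∈ V := by
  push Not at hall
  have hTc : IsCompact (Icc a b ∩ c ⁻¹' Vᶜ) :=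
    isCompact_Icc.of_isClosed_subset
      (hc.preimage_isClosed_of_isClosed isClosed_Icc hV.isClosed_compl) inter_subset_left
  obtain ⟨t₁, ⟨ht₁, ht₁V⟩, hleast⟩ := hTc.exists_isLeast (by
    obtain ⟨t, ht, htV⟩ := hall
    exact ⟨t, ht, htV⟩)
  refine ⟨t₁, ⟨ht₁.1.lt_of_ne ?_, ht₁.2⟩, ht₁V, fun t ht => ?_⟩
  · rintro rfl
    exact ht₁V ha
  · by_contra h
    exact (hleast ⟨⟨ht.1, ht.2.le.trans ht₁.2⟩, h⟩).not_gt ht.2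

/-- A path starting in a ball of a chart either stays there or is at least as long as its distance
to the boundary of the ball. -/
theorem forall_mem_or_le_pathLength (he : e ∈ IsManifold.maximalAtlas 𝓘(ℝ, X) 1 M)
    {n : Seminorm ℝ X} {K : ℝ} (hn2 : ∀ v, n v ≤ K * ‖v‖) {y₀ : X} {r C : ℝ} (hC : 0 ≤ C)
    (hr : ∀ y, n (y - y₀) < r → ∀ v, n v ≤ C * chartNorm F.nrm e y v)
    (hcl : ∀ r' < r, IsClosed {p | p ∈ e.source ∧ n (e p - y₀) ≤ r'})
    (hc : IsPiecewiseC1Path X c a b) (ha : c a ∈ e.source) (har : n (e (c a) - y₀) < r) :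
    (∀ t ∈ Icc a b, c t ∈ e.source ∧ n (e (c t) - y₀) < r) ∨
      r - n (e (c a) - y₀) ≤ C * F.pathLength c a b := by
  have hnc := Seminorm.continuous_of_le_mul_norm hn2
  set V : Set M := {p | p ∈ e.source ∧ n (e p - y₀) < r} with hV
  have hVo : IsOpen V := e.continuousOn.isOpen_inter_preimage e.open_source
    (isOpen_lt (by fun_prop) continuous_const : IsOpen {y | n (y - y₀) < r})
  by_cases hall : ∀ t ∈ Icc a b, c t ∈ V
  · exact Or.inl hall
  right
  obtain ⟨t₁, ht₁, ht₁V, hbefore⟩ := exists_first_exit hc.continuousOn hVo ⟨ha, har⟩ hall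
  have hat₁ := ht₁.1
  refine le_of_forall_lt fun s hs => ?_
  obtain ⟨r', hsr', hr'⟩ := exists_between (show s + n (e (c a) - y₀) < r by linarith)
  -- If the path stayed within radius `r'` before `t₁`, closedness would put `c t₁` itself in the
  -- smaller ball, hence in `V`.
  obtain ⟨t, ht, htr⟩ : ∃ t ∈ Ico a t₁, r' < n (e (c t) - y₀) := by
    by_contra! hcon
    have hm : MapsTo c (Ico a t₁) {p | p ∈ e.source ∧ n (e p - y₀) ≤ r'} :=
      fun t ht => ⟨(hbefore t ht).1, hcon t ht⟩
    have := hm.closure_of_continuousOn (by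
      rw [closure_Ico hat₁.ne]
      exact hc.continuousOn.mono (Icc_subset_Icc_right ht₁.2))
    rw [closure_Ico hat₁.ne, (hcl r' hr').closure_eq] at this
    obtain ⟨h1, h2⟩ := this ⟨hat₁.le, le_rfl⟩
    exact ht₁V ⟨h1, lt_of_le_of_lt h2 hr'⟩
  have htb : t ≤ b := ht.2.le.trans ht₁.2
  have h1 := sub_le_pathLength (F := F) he hn2 (hc.mono le_rfl ht.1 htb) fun u hu => by
    have := hbefore u ⟨hu.1, hu.2.trans_lt ht.2⟩
    exact ⟨this.1, hr _ this.2⟩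
  have h2 := mul_le_mul_of_nonneg_left (pathLength_mono (F := F) hc le_rfl ht.1 htb) hC
  have h3 := map_add_le_add n (e (c t) - e (c a)) (e (c a) - y₀)
  rw [sub_add_sub_cancel] at h3
  linarith

end PalaisFinsler

/-! ### The Finsler distance as a metric, and its comparison with charts. -/

namespace PalaisFinsler

variable {X M : Type*} [NormedAddCommGroup X] [NormedSpace ℝ X]
  [TopologicalSpace M] [ChartedSpace X M] [IsManifold 𝓘(ℝ, X) 1 M] {F : PalaisFinsler X M}
  {c : ℝ → M} {a b : ℝ} {e : OpenPartialHomeomorph M X}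

theorem segment_subset_of_seminorm_le {n : Seminorm ℝ X} {y₀ y z : X} {R : ℝ}
    (hy : n (y - y₀) ≤ R) (hz : n (z - y₀) ≤ R) :
    ∀ w ∈ segment ℝ y z, n (w - y₀) ≤ R := by
  rintro w ⟨s, t, hs, ht, hst, rfl⟩
  have e : s • y + t • z - y₀ = s • (y - y₀) + t • (z - y₀) := by
    have : y₀ = (s + t) • y₀ := by rw [hst, one_smul]
    nth_rewrite 1 [this]
    module
  rw [e]
  refine (map_add_le_add n _ _).trans ?_
  rw [map_smul_eq_mul, map_smul_eq_mul, Real.norm_of_nonneg hs, Real.norm_of_nonneg ht]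
  calc s * n (y - y₀) + t * n (z - y₀) ≤ s * R + t * R := by gcongr
    _ = R := by rw [← add_mul, hst, one_mul]

theorem fdist_path_le (hc : IsPiecewiseC1Path X c a b) {s t : ℝ} (has : a ≤ s) (hst : s ≤ t)
    (htb : t ≤ b) : F.fdist (c s) (c t) ≤ F.pathLength c s t :=
  fdist_le_of_mem ⟨c, s, t, hst, hc.mono has hst htb, rfl, rfl, rfl⟩

theorem eventually_nonempty_lengths (F : PalaisFinsler X M) [RegularSpace M] (x₀ : M) :
    ∀ᶠ p in 𝓝 x₀, (F.lengths x₀ p).Nonempty := by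
  have he := IsManifold.chart_mem_maximalAtlas (I := 𝓘(ℝ, X)) (n := 1) x₀
  have hx₀ := mem_chart_source X x₀
  obtain ⟨K, hK, hn1, hn2⟩ := F.exists_equivalent he hx₀
  obtain ⟨R, hR, hball, -⟩ := F.exists_chart_ball he hx₀ one_pos univ_mem
  set n := F.chartSeminorm (chartAt X x₀) (chartAt X x₀ x₀)
  have hnc := Seminorm.continuous_of_le_mul_norm hn2
  have h0 : Tendsto (fun y => n (y - chartAt X x₀ x₀)) (𝓝 (chartAt X x₀ x₀)) (𝓝 0) :=
    Continuous.tendsto' (by fun_prop) _ _ (by simp)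
  filter_upwards [(chartAt X x₀).open_source.mem_nhds hx₀,
    ((chartAt X x₀).continuousAt hx₀).eventually (h0.eventually_lt_const hR)] with p hp hpR
  obtain ⟨r, hr, -⟩ := exists_mem_lengths_le (F := F) he (n := n) (C := 1 + 1)
    (y := chartAt X x₀ x₀) (z := chartAt X x₀ p) fun w hw => by
      have := hball w (segment_subset_of_seminorm_le (by simpa using hR.le) hpR.le w hw)
      exact ⟨this.1, fun v => (this.2.2 v).2⟩
  rw [(chartAt X x₀).left_inv hx₀, (chartAt X x₀).left_inv hp] at hr
  exact ⟨r, hr⟩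

variable [RegularSpace M] [ConnectedSpace M]

/-- Points joined to `p` form a clopen set. Without a path the infimum would take the default value
`0`. -/
theorem lengths_nonempty (F : PalaisFinsler X M) (p q : M) : (F.lengths p q).Nonempty := by
  have hcl : IsClopen {q | (F.lengths p q).Nonempty} := by
    refine ⟨⟨?_⟩, ?_⟩
    · rw [isOpen_iff_mem_nhds]
      intro q hq
      filter_upwards [F.eventually_nonempty_lengths q] with q' hq'
      rintro ⟨r, hr⟩
      obtain ⟨r', hr'⟩ := hq'
      exact hq ⟨_, add_mem_lengths hr (lengths_symm hr')⟩
    · rw [isOpen_iff_mem_nhds]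
      rintro q ⟨r, hr⟩
      filter_upwards [F.eventually_nonempty_lengths q] with q' hq'
      obtain ⟨r', hr'⟩ := hq'
      exact ⟨_, add_mem_lengths hr hr'⟩
  have := hcl.eq_univ ⟨p, ⟨0, F.zero_mem_lengths p⟩⟩
  exact eq_univ_iff_forall.1 this q

theorem exists_path_lt (F : PalaisFinsler X M) (p q : M) {r : ℝ} (hr : F.fdist p q < r) :
    ∃ (c : ℝ → M) (a b : ℝ), a ≤ b ∧ IsPiecewiseC1Path X c a b ∧ c a = p ∧ c b = q ∧
      F.pathLength c a b < r := by
  obtain ⟨_, ⟨c, a, b, hab, hc, hp, hq, rfl⟩, hlt⟩ :=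
    exists_lt_of_csInf_lt (F.lengths_nonempty p q) hr
  exact ⟨c, a, b, hab, hc, hp, hq, hlt⟩

theorem fdist_triangle (F : PalaisFinsler X M) (p q m : M) :
    F.fdist p m ≤ F.fdist p q + F.fdist q m := by
  refine le_of_forall_pos_lt_add fun ε hε => ?_
  obtain ⟨r, hr, hr'⟩ := exists_lt_of_csInf_lt (F.lengths_nonempty p q)
    (show F.fdist p q < F.fdist p q + ε / 2 by linarith)
  obtain ⟨s, hs, hs'⟩ := exists_lt_of_csInf_lt (F.lengths_nonempty q m)
    (show F.fdist q m < F.fdist q m + ε / 2 by linarith)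
  linarith [fdist_le_of_mem (add_mem_lengths hr hs)]

/-- Near each point, the Finsler distance is almost equal to the distance in a chart. -/
theorem exists_local_comparison (F : PalaisFinsler X M)
    (he : e ∈ IsManifold.maximalAtlas 𝓘(ℝ, X) 1 M) {x₀ : M} (hx₀ : x₀ ∈ e.source) {ε : ℝ}
    (hε : 0 < ε) : ∃ W ∈ 𝓝 x₀, W ⊆ e.source ∧ ∀ p ∈ W, ∀ q ∈ W,
      F.fdist p q ≤ (1 + ε) * F.chartSeminorm e (e x₀) (e q - e p) ∧
      F.chartSeminorm e (e x₀) (e q - e p) ≤ (1 + ε) * F.fdist p q := by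
  obtain ⟨K, hK, hn1, hn2⟩ := F.exists_equivalent he hx₀
  obtain ⟨R, hR, hball, hcl⟩ := F.exists_chart_ball he hx₀ hε univ_mem
  set n := F.chartSeminorm e (e x₀)
  have hnc := Seminorm.continuous_of_le_mul_norm hn2
  have h0 : Tendsto (fun y => n (y - e x₀)) (𝓝 (e x₀)) (𝓝 0) :=
    Continuous.tendsto' (by fun_prop) _ _ (by simp)
  -- With radius `R / 4`, a path leaving the ball of radius `R` costs at least `3 * R / 4`, more
  -- than the distance, less than `R / 2`, of the two points in the chart.
  refine ⟨{p | p ∈ e.source ∧ n (e p - e x₀) < R / 4}, ?_, fun p hp => hp.1, ?_⟩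
  · filter_upwards [e.open_source.mem_nhds hx₀, (e.continuousAt hx₀).eventually
      (h0.eventually_lt_const (by positivity : 0 < R / 4))] with p hp hpR using ⟨hp, hpR⟩
  rintro p ⟨hp, hpR⟩ q ⟨hq, hqR⟩
  constructor
  · obtain ⟨r, hr, hrn⟩ := exists_mem_lengths_le (F := F) he (n := n) (C := 1 + ε)
      (y := e p) (z := e q) fun w hw => by
        have := hball w (segment_subset_of_seminorm_le (by linarith) (by linarith) w hw)
        exact ⟨this.1, fun v => (this.2.2 v).2⟩
    rw [e.left_inv hp, e.left_inv hq] at hr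
    exact (fdist_le_of_mem hr).trans hrn
  · rw [← div_le_iff₀' (by linarith)]
    refine le_csInf (F.lengths_nonempty p q) ?_
    rintro _ ⟨c, a, b, hab, hc, rfl, rfl, rfl⟩
    rw [div_le_iff₀' (by linarith)]
    rcases forall_mem_or_le_pathLength (F := F) he hn2 (C := 1 + ε) (r := R) (by linarith)
      (fun y hy v => ((hball y hy.le).2.2 v).1) (fun r' hr' => hcl r' hr'.le) hc hp
      (by linarith) with h | h
    · exact sub_le_pathLength he hn2 hc fun t ht =>
        ⟨(h t ht).1, fun v => ((hball _ (h t ht).2.le).2.2 v).1⟩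
    · have h1 := map_sub_le_add n (e (c b) - e x₀) (e (c a) - e x₀)
      rw [sub_sub_sub_cancel_right] at h1
      linarith

/-- A path from `x₀` that is too short cannot leave a ball of the chart. With `eventually_fdist_lt`,
this shows that the distance induces the topology of `M`. -/
theorem exists_ball_subset (F : PalaisFinsler X M) {x₀ : M} {U : Set M} (hU : U ∈ 𝓝 x₀) :
    ∃ δ > 0, ∀ p, F.fdist x₀ p < δ → p ∈ U := by
  have he := IsManifold.chart_mem_maximalAtlas (I := 𝓘(ℝ, X)) (n := 1) x₀
  have hx₀ := mem_chart_source X x₀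
  obtain ⟨K, hK, hn1, hn2⟩ := F.exists_equivalent he hx₀
  obtain ⟨R, hR, hball, hcl⟩ := F.exists_chart_ball he hx₀ one_pos hU
  refine ⟨R / 2, by positivity, fun p hp => ?_⟩
  obtain ⟨c, a, b, hab, hc, rfl, rfl, hlt⟩ := F.exists_path_lt _ _ hp
  rcases forall_mem_or_le_pathLength (F := F) he hn2 (C := 1 + 1) (r := R) (by norm_num)
    (fun y hy v => ((hball y hy.le).2.2 v).1) (fun r' hr' => hcl r' hr'.le) hc hx₀
    (by simpa using hR) with h | h
  · obtain ⟨h1, h2⟩ := h b ⟨hab, le_rfl⟩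
    have := (hball _ h2.le).2.1
    rwa [(chartAt X (c a)).left_inv h1] at this
  · rw [sub_self, map_zero] at h
    linarith

theorem eventually_fdist_lt (F : PalaisFinsler X M) (x₀ : M) {ε : ℝ} (hε : 0 < ε) :
    ∀ᶠ p in 𝓝 x₀, F.fdist x₀ p < ε := by
  have he := IsManifold.chart_mem_maximalAtlas (I := 𝓘(ℝ, X)) (n := 1) x₀
  have hx₀ := mem_chart_source X x₀
  obtain ⟨K, hK, hn1, hn2⟩ := F.exists_equivalent he hx₀
  obtain ⟨W, hW, -, hWd⟩ := F.exists_local_comparison he hx₀ one_pos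
  have hnc := Seminorm.continuous_of_le_mul_norm hn2
  have h0 : Tendsto (fun y => (1 + 1) * F.chartSeminorm (chartAt X x₀) (chartAt X x₀ x₀)
      (y - chartAt X x₀ x₀)) (𝓝 (chartAt X x₀ x₀)) (𝓝 0) :=
    Continuous.tendsto' (by fun_prop) _ _ (by simp)
  filter_upwards [hW, ((chartAt X x₀).continuousAt hx₀).eventually (h0.eventually_lt_const hε)]
    with p hp hpε
  exact (hWd x₀ (mem_of_mem_nhds hW) p hp).1.trans_lt hpε

theorem continuous_fdist (F : PalaisFinsler X M) (p : M) : Continuous (F.fdist p) := by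
  rw [continuous_iff_continuousAt]
  intro q
  rw [ContinuousAt, Metric.tendsto_nhds]
  intro ε hε
  filter_upwards [F.eventually_fdist_lt q hε] with q' hq'
  rw [Real.dist_eq, abs_lt]
  have h1 := F.fdist_triangle p q q'
  have h2 := F.fdist_triangle p q' q
  rw [F.fdist_comm q' q] at h2
  constructor <;> linarith

/-- Points at a prescribed small distance which are almost on a geodesic. -/
theorem exists_fdist_eq_add_le (F : PalaisFinsler X M) (p q : M) {r η : ℝ} (hr : 0 ≤ r)
    (hrq : r ≤ F.fdist p q) (hη : 0 < η) :
    ∃ m, F.fdist p m = r ∧ r + F.fdist m q ≤ F.fdist p q + η := by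
  obtain ⟨c, a, b, hab, hc, rfl, rfl, hlt⟩ := F.exists_path_lt p q
    (show F.fdist p q < F.fdist p q + η by linarith)
  have hcont : ContinuousOn (fun t => F.fdist (c a) (c t)) (Icc a b) :=
    (F.continuous_fdist _).comp_continuousOn hc.continuousOn
  obtain ⟨t, ht, htr⟩ := intermediate_value_Icc hab hcont
    (show r ∈ Icc (F.fdist (c a) (c a)) (F.fdist (c a) (c b)) from ⟨by rwa [fdist_self], hrq⟩)
  refine ⟨c t, htr, ?_⟩
  have h1 := fdist_path_le (F := F) hc le_rfl ht.1 ht.2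
  have h2 := fdist_path_le (F := F) hc ht.1 ht.2 le_rfl
  have h3 := (hc.mono le_rfl ht.1 ht.2).pathLength_add (F := F) (hc.mono ht.1 ht.2 le_rfl)
  simp only at htr
  linarith

end PalaisFinsler

/-! ### Test functions and dual norms in charts; metric form of the viscosity inequalities. -/

theorem OpenPartialHomeomorph.isLocalMin_comp {X M : Type*}
    [TopologicalSpace X] [TopologicalSpace M] {e : OpenPartialHomeomorph M X} {p : M}
    (hp : p ∈ e.source) {V : M → ℝ} {G : X → ℝ} {g : M → ℝ}
    (hg : g =ᶠ[𝓝 p] fun q => G (e q))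
    (h : IsLocalMin (fun y => V (e.symm y) - G y) (e p)) : IsLocalMin (fun q => V q - g q) p := by
  filter_upwards [e.open_source.mem_nhds hp, hg, (e.continuousAt hp).eventually h] with q hq hgq hq'
  rw [hg.eq_of_nhds, hgq]
  simpa [e.left_inv hp, e.left_inv hq] using hq'

theorem OpenPartialHomeomorph.isLocalMax_comp {X M : Type*}
    [TopologicalSpace X] [TopologicalSpace M] {e : OpenPartialHomeomorph M X} {p : M}
    (hp : p ∈ e.source) {V : M → ℝ} {G : X → ℝ} {g : M → ℝ}
    (hg : g =ᶠ[𝓝 p] fun q => G (e q))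
    (h : IsLocalMax (fun y => V (e.symm y) - G y) (e p)) : IsLocalMax (fun q => V q - g q) p := by
  filter_upwards [e.open_source.mem_nhds hp, hg, (e.continuousAt hp).eventually h] with q hq hgq hq'
  rw [hg.eq_of_nhds, hgq]
  simpa [e.left_inv hp, e.left_inv hq] using hq'

namespace PalaisFinsler

variable {X M : Type*} [NormedAddCommGroup X] [NormedSpace ℝ X]
  [TopologicalSpace M] [ChartedSpace X M] {e : OpenPartialHomeomorph M X}

/-- With a `C^1` bump function on the model space, functions of class `C^1` in a chart extend from
a neighborhood of a point to the whole manifold. -/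
theorem _root_.IsUnitBump.exists_contMDiff_eventuallyEq [RegularSpace M] {β : X → ℝ}
    (hβ : IsUnitBump β) (he : e ∈ IsManifold.maximalAtlas 𝓘(ℝ, X) 1 M) {p : M} (hp : p ∈ e.source)
    {G : X → ℝ} (hG : ContDiff ℝ 1 G) :
    ∃ g : M → ℝ, ContMDiff 𝓘(ℝ, X) 𝓘(ℝ, ℝ) 1 g ∧ g =ᶠ[𝓝 p] fun q => G (e q) := by
  classical
  obtain ⟨C, hC, hCc, hCs⟩ := exists_mem_nhds_isClosed_subset (e.open_source.mem_nhds hp)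
  have hnh : e.target ∩ e.symm ⁻¹' C ∈ 𝓝 (e p) := by
    refine inter_mem (e.open_target.mem_nhds (e.map_source hp))
      (e.continuousAt_symm (e.map_source hp) ?_)
    rwa [e.left_inv hp]
  obtain ⟨δ, hδ, hδs⟩ := Metric.nhds_basis_ball.mem_iff.1 hnh
  let χ : X → ℝ := fun y => β (δ⁻¹ • (y - e p)) * G y
  have hχ : ContDiff ℝ 1 χ :=
    (hβ.contDiff.comp (contDiff_const.smul (contDiff_id.sub contDiff_const))).mul hG
  let g : M → ℝ := fun q => if q ∈ e.source then χ (e q) else 0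
  have hgs : ∀ q ∈ e.source, g q = χ (e q) := fun q hq => if_pos hq
  have hg0 : ∀ q ∉ C, g q = 0 := by
    intro q hq
    by_cases hqs : q ∈ e.source
    · rw [hgs q hqs]
      suffices β (δ⁻¹ • (e q - e p)) = 0 by simp only [χ, this, zero_mul]
      apply hβ.eq_zero
      rw [norm_smul, Real.norm_of_nonneg (by positivity), ← div_eq_inv_mul, le_div_iff₀ hδ, one_mul]
      by_contra! hlt
      have := (hδs (mem_ball_iff_norm.2 hlt)).2
      rw [mem_preimage, e.left_inv hqs] at this
      exact hq this
    · exact if_neg hqs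
  refine ⟨g, fun q => ?_, ?_⟩
  · by_cases hq : q ∈ e.source
    · refine ((hχ.contMDiff (e q)).comp q
        ((contMDiffOn_of_mem_maximalAtlas he).contMDiffAt
          (e.open_source.mem_nhds hq))).congr_of_eventuallyEq ?_
      filter_upwards [e.open_source.mem_nhds hq] with q' hq' using hgs q' hq'
    · refine (contMDiffAt_const (c := (0 : ℝ))).congr_of_eventuallyEq ?_
      filter_upwards [hCc.isOpen_compl.mem_nhds fun h => hq (hCs h)] with q' hq' using hg0 q' hq'
  · have ht : Tendsto (fun q => δ⁻¹ • (e q - e p)) (𝓝 p) (𝓝 0) := by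
      have : Tendsto (fun y => δ⁻¹ • (y - e p)) (𝓝 (e p)) (𝓝 0) :=
        Continuous.tendsto' (by fun_prop) _ _ (by simp)
      exact this.comp (e.continuousAt hp)
    filter_upwards [e.open_source.mem_nhds hp, ht.eventually hβ.eventually_eq_one] with q hq h1
    rw [hgs q hq]
    simp only [χ, h1, one_mul]

theorem mfderiv_eq_of_eventuallyEq {p : M} {G : X → ℝ} (hG : ContDiff ℝ 1 G) {g : M → ℝ}
    (hg : g =ᶠ[𝓝 p] fun q => G (e q)) {E : X →L[ℝ] X}
    (hE : HasMFDerivAt 𝓘(ℝ, X) 𝓘(ℝ, X) e p E) :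
    (mfderiv 𝓘(ℝ, X) 𝓘(ℝ, ℝ) g p : X →L[ℝ] ℝ) = (fderiv ℝ G (e p)).comp E := by
  have h1 : HasMFDerivAt 𝓘(ℝ, X) 𝓘(ℝ, ℝ) G (e p) (fderiv ℝ G (e p)) :=
    (hG.differentiable (by norm_num) (e p)).hasFDerivAt.hasMFDerivAt
  exact ((h1.comp p hE).congr_of_eventuallyEq hg).mfderiv

theorem exists_hasMFDerivAt_surjective (he : e ∈ IsManifold.maximalAtlas 𝓘(ℝ, X) 1 M) {p : M}
    (hp : p ∈ e.source) : ∃ E : X →L[ℝ] X, HasMFDerivAt 𝓘(ℝ, X) 𝓘(ℝ, X) e p E ∧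
      Function.Surjective E :=
  ⟨_, ((mdifferentiable_of_mem_maximalAtlas he).mdifferentiableAt hp).hasMFDerivAt,
    (mdifferentiable_of_mem_maximalAtlas he).mfderiv_surjective hp⟩

variable [IsManifold 𝓘(ℝ, X) 1 M] {F : PalaisFinsler X M}

section dualNorm

variable {x : M} {D : X →L[ℝ] ℝ}

theorem dualNorm_nonneg : 0 ≤ F.dualNorm x D := by
  refine Real.sSup_nonneg ?_
  rintro _ ⟨ξ, -, rfl⟩
  exact abs_nonneg _

theorem dualNorm_le {κ : ℝ} (hκ : 0 ≤ κ) (h : ∀ v, |D v| ≤ κ * F.modelNrm x v) :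
    F.dualNorm x D ≤ κ := by
  refine Real.sSup_le ?_ hκ
  rintro _ ⟨ξ, hξ, rfl⟩
  have hξ : F.modelNrm x ξ = 1 := hξ
  have := h ξ
  rwa [hξ, mul_one] at this

/-- Bounds the set whose supremum is the dual norm; an unbounded set would have the default supremum
`0`. -/
theorem exists_norm_le_nrm (F : PalaisFinsler X M) (x : M) :
    ∃ C : ℝ, 0 ≤ C ∧ ∀ v : X, ‖v‖ ≤ C * F.modelNrm x v := by
  have he := IsManifold.chart_mem_maximalAtlas (I := 𝓘(ℝ, X)) (n := 1) x
  have hx := mem_chart_source X x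
  obtain ⟨K, hK, hn1, -⟩ := F.exists_equivalent he hx
  have hmd := mdifferentiable_of_mem_maximalAtlas he
  set E : X →L[ℝ] X := mfderiv 𝓘(ℝ, X) 𝓘(ℝ, X) (chartAt X x) x with hE
  set E' : X →L[ℝ] X := mfderiv 𝓘(ℝ, X) 𝓘(ℝ, X) (chartAt X x).symm (chartAt X x x) with hE'
  have hEE : ∀ v, E' (E v) = v := fun v =>
    congrArg (fun A : X →L[ℝ] X => A v) (hmd.symm_comp_deriv hx)
  refine ⟨‖E'‖ * K, by positivity, fun v => ?_⟩
  have h1 := hn1 (E v)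
  rw [chartSeminorm_apply, chartNorm_mfderiv he hx (hmd.mdifferentiableAt hx).hasMFDerivAt] at h1
  calc ‖v‖ = ‖E' (E v)‖ := by rw [hEE]
    _ ≤ ‖E'‖ * ‖E v‖ := E'.le_opNorm _
    _ ≤ ‖E'‖ * (K * F.modelNrm x v) := by gcongr
    _ = _ := by ring

theorem abs_le_dualNorm_mul (v : X) : |D v| ≤ F.dualNorm x D * F.modelNrm x v := by
  obtain ⟨C, hC, hCn⟩ := F.exists_norm_le_nrm x
  have hbdd : BddAbove {r | ∃ v : X, F.modelNrm x v = 1 ∧ |D v| = r} := by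
    refine ⟨‖D‖ * C, ?_⟩
    rintro _ ⟨v, hv, rfl⟩
    have h2 := hCn v
    rw [hv, mul_one] at h2
    exact (D.le_opNorm v).trans (mul_le_mul_of_nonneg_left h2 (norm_nonneg _))
  have h0 : 0 ≤ F.modelNrm x v := apply_nonneg (F.nrm x) v
  rcases h0.eq_or_lt with h0 | h0
  · have : v = 0 := norm_le_zero_iff.1 (by simpa [← h0] using hCn v)
    subst this
    rw [map_zero, abs_zero, ← h0, mul_zero]
  · have h1 : F.modelNrm x ((F.modelNrm x v)⁻¹ • v) = 1 := by
      rw [modelNrm_smul, abs_of_nonneg (by positivity), inv_mul_cancel₀ h0.ne']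
    have h2 : |D ((F.modelNrm x v)⁻¹ • v)| ≤ F.dualNorm x D := le_csSup hbdd ⟨_, h1, rfl⟩
    rw [map_smul, smul_eq_mul, abs_mul, abs_of_nonneg (by positivity), inv_mul_le_iff₀ h0] at h2
    linarith

end dualNorm

variable [CompleteSpace X] [RegularSpace M] [ConnectedSpace M]

/-- A function whose superdifferentials have norm at most `1` grows at a rate at most `L > 1`. -/
theorem eventually_sub_le_of_superdifferential {β : X → ℝ} (hβ : IsUnitBump β)
    (F : PalaisFinsler X M) {Ω : Set M} (hΩ : IsOpen Ω) {V : M → ℝ} (hV : ContinuousOn V Ω)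
    (hsub : ∀ x ∈ Ω, ∀ g : M → ℝ, ContMDiff 𝓘(ℝ, X) 𝓘(ℝ, ℝ) 1 g →
      IsLocalMax (fun y => V y - g y) x →
      F.dualNorm x (mfderiv 𝓘(ℝ, X) 𝓘(ℝ, ℝ) g x) ≤ 1)
    {x₀ : M} (hx₀ : x₀ ∈ Ω) {L : ℝ} (hL : 1 < L) :
    ∀ᶠ y in 𝓝 x₀, V y - V x₀ ≤ L * F.fdist x₀ y := by
  have he := IsManifold.chart_mem_maximalAtlas (I := 𝓘(ℝ, X)) (n := 1) x₀
  have hxe := mem_chart_source X x₀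
  set e := chartAt X x₀
  -- One factor `1 + ε` comes from the norms at nearby points, one from the distance, and a further
  -- `ε` is the strict gap between `L₀` and `L`. For `ε ≤ 1` the product `(1 + 2 * ε) * (1 + ε)` is
  -- at most `1 + 5 * ε`.
  set ε : ℝ := min 1 ((L - 1) / 5) with hε
  have hε0 : 0 < ε := by
    have : 0 < L - 1 := by linarith
    positivity
  have hε1 : ε ≤ 1 := min_le_left _ _
  have hεL : (1 + 2 * ε) * (1 + ε) ≤ L := by
    have : ε ≤ (L - 1) / 5 := min_le_right _ _
    nlinarith
  obtain ⟨K, hK, hn1, hn2⟩ := F.exists_equivalent he hxe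
  obtain ⟨R, hR, hball, -⟩ := F.exists_chart_ball he hxe hε0 (hΩ.mem_nhds hx₀)
  obtain ⟨W, hW, hWe, hWd⟩ := F.exists_local_comparison he hxe hε0
  set n := F.chartSeminorm e (e x₀) with hn
  have hnc := Seminorm.continuous_of_le_mul_norm hn2
  have hO : IsOpen {y | n (y - e x₀) < R} := isOpen_lt (by fun_prop) continuous_const
  have key := hβ.eventually_sub_le hK hn1 hn2 (w := fun y => V (e.symm y)) hO
    (hV.comp (e.continuousOn_symm.mono fun y hy => (hball y (le_of_lt hy)).1)
      fun y hy => (hball y (le_of_lt hy)).2.1) (y₀ := e x₀) (by simpa using hR)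
    (L₀ := 1 + ε) (L := 1 + 2 * ε) (by linarith) (by linarith) (by
      intro y hy G hG hmax v
      obtain ⟨hyt, hyΩ, hyn⟩ := hball y (le_of_lt hy)
      have hps := e.map_target hyt
      obtain ⟨g, hg, hgG⟩ := hβ.exists_contMDiff_eventuallyEq he hps hG
      obtain ⟨E, hE, hEs⟩ := exists_hasMFDerivAt_surjective he hps
      have h1 := hsub _ hyΩ g hg (e.isLocalMax_comp hps hgG (by rwa [e.right_inv hyt]))
      obtain ⟨w, rfl⟩ := hEs v
      have h2 : F.dualNorm (e.symm y) ((fderiv ℝ G (e (e.symm y))).comp E) ≤ 1 :=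
        (congrArg (F.dualNorm (e.symm y)) (mfderiv_eq_of_eventuallyEq hG hgG hE)).symm.trans_le h1
      have h3 := (abs_le_dualNorm_mul (F := F) (x := e.symm y) w).trans
        (mul_le_of_le_one_left (apply_nonneg (F.nrm (e.symm y)) w) h2)
      rw [← chartNorm_mfderiv he hps hE, e.right_inv hyt] at h3
      exact h3.trans (hyn _).2)
  filter_upwards [(e.continuousAt hxe).eventually key, hW] with q hq hqW
  rw [e.left_inv hxe, e.left_inv (hWe hqW)] at hq
  have h1 := (hWd x₀ (mem_of_mem_nhds hW) q hqW).2
  have h2 := mul_le_mul_of_nonneg_left h1 (by linarith : 0 ≤ 1 + 2 * ε)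
  have h3 := mul_le_mul_of_nonneg_right hεL (fdist_nonneg (F := F) (p := x₀) (q := q))
  linarith

/-- A function whose subdifferentials have norm at least `1` does not lie above a cone of slope
`θ < 1` around a point of its graph. -/
theorem not_eventually_sub_le_of_subdifferential {β : X → ℝ} (hβ : IsUnitBump β)
    (F : PalaisFinsler X M) {Ω : Set M} (hΩ : IsOpen Ω) {V : M → ℝ} (hV : ContinuousOn V Ω)
    (hsuper : ∀ x ∈ Ω, ∀ g : M → ℝ, ContMDiff 𝓘(ℝ, X) 𝓘(ℝ, ℝ) 1 g →
      IsLocalMin (fun y => V y - g y) x →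
      1 ≤ F.dualNorm x (mfderiv 𝓘(ℝ, X) 𝓘(ℝ, ℝ) g x))
    {x₀ : M} (hx₀ : x₀ ∈ Ω) {θ : ℝ} (hθ0 : 0 ≤ θ) (hθ : θ < 1) :
    ¬ ∀ᶠ y in 𝓝 x₀, V x₀ - θ * F.fdist x₀ y ≤ V y := by
  intro hcone
  have he := IsManifold.chart_mem_maximalAtlas (I := 𝓘(ℝ, X)) (n := 1) x₀
  have hxe := mem_chart_source X x₀
  set e := chartAt X x₀
  -- Then `(1 + θ) / 2 = 1 - 2 * ε` lies strictly above the slope `θ * (1 + ε)` in the chart and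
  -- stays below `1` after multiplication by `1 + ε`.
  set ε : ℝ := (1 - θ) / 4 with hε
  have hε0 : 0 < ε := by linarith
  have hε1 : θ * (1 + ε) < (1 + θ) / 2 := by nlinarith
  have hε2 : (1 + θ) / 2 * (1 + ε) < 1 := by nlinarith
  obtain ⟨K, hK, hn1, hn2⟩ := F.exists_equivalent he hxe
  obtain ⟨W, hW, hWe, hWd⟩ := F.exists_local_comparison he hxe hε0
  obtain ⟨R, hR, hball, -⟩ := F.exists_chart_ball he hxe hε0
    (inter_mem (inter_mem (hΩ.mem_nhds hx₀) hW) hcone)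
  set n := F.chartSeminorm e (e x₀) with hn
  have hnc := Seminorm.continuous_of_le_mul_norm hn2
  have hρ : ∀ y ∈ Metric.closedBall (e x₀) (R / K), n (y - e x₀) ≤ R := fun y hy => by
    have h1 := mul_le_mul_of_nonneg_left (mem_closedBall_iff_norm.1 hy) hK.le
    rw [mul_div_cancel₀ _ hK.ne'] at h1
    exact (hn2 _).trans h1
  obtain ⟨y, hy, G, hG, hmin, hGn⟩ := hβ.exists_isLocalMin_sub hK hn1 hn2
    (w := fun y => V (e.symm y)) (y₀ := e x₀) (ρ := R / K) (by positivity)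
    (hV.comp (e.continuousOn_symm.mono fun y hy => (hball y (hρ y hy)).1)
      fun y hy => (hball y (hρ y hy)).2.1.1.1)
    (θ₁ := θ * (1 + ε)) (by positivity) hε1 (by
      intro y hy
      obtain ⟨hyt, ⟨⟨-, hyW⟩, hyc⟩, -⟩ := hball y (hρ y hy)
      have hyc : V x₀ - θ * F.fdist x₀ (e.symm y) ≤ V (e.symm y) := hyc
      have h1 := (hWd x₀ (mem_of_mem_nhds hW) _ hyW).1
      rw [e.right_inv hyt] at h1
      have h2 := mul_le_mul_of_nonneg_left h1 hθ0
      rw [e.left_inv hxe]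
      linarith)
  obtain ⟨hyt, ⟨⟨hyΩ, -⟩, -⟩, hyn⟩ := hball y (hρ y (Metric.ball_subset_closedBall hy))
  have hps := e.map_target hyt
  obtain ⟨g, hg, hgG⟩ := hβ.exists_contMDiff_eventuallyEq he hps hG
  obtain ⟨E, hE, hEs⟩ := exists_hasMFDerivAt_surjective he hps
  have h1 := hsuper _ hyΩ g hg (e.isLocalMin_comp hps hgG (by rwa [e.right_inv hyt]))
  rw [congrArg (F.dualNorm (e.symm y)) (mfderiv_eq_of_eventuallyEq hG hgG hE)] at h1
  refine absurd (h1.trans (dualNorm_le (κ := (1 + θ) / 2 * (1 + ε)) (by positivity) fun v => ?_))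
    hε2.not_ge
  rw [← chartNorm_mfderiv he hps hE, e.right_inv hyt, mul_assoc]
  exact (hGn (E v)).trans (mul_le_mul_of_nonneg_left (hyn _).1 (by positivity))

end PalaisFinsler

/-! ### Slopes along paths, slopes of test functions and Ekeland's principle. -/

namespace PalaisFinsler

variable {X M : Type*} [NormedAddCommGroup X] [NormedSpace ℝ X]
  [TopologicalSpace M] [ChartedSpace X M] {e : OpenPartialHomeomorph M X}

theorem exists_hasFDerivAt_chart (he : e ∈ IsManifold.maximalAtlas 𝓘(ℝ, X) 1 M) {p : M}
    (hp : p ∈ e.source) {g : M → ℝ} (hg : MDifferentiableAt 𝓘(ℝ, X) 𝓘(ℝ, ℝ) g p) :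
    ∃ (A : X →L[ℝ] ℝ) (E : X →L[ℝ] X), HasFDerivAt (fun y => g (e.symm y)) A (e p) ∧
      HasMFDerivAt 𝓘(ℝ, X) 𝓘(ℝ, X) e p E ∧ Function.Surjective E ∧
      (mfderiv 𝓘(ℝ, X) 𝓘(ℝ, ℝ) g p : X →L[ℝ] ℝ) = A.comp E := by
  obtain ⟨E, hE, hEs⟩ := exists_hasMFDerivAt_surjective he hp
  have h1 : MDifferentiableAt 𝓘(ℝ, X) 𝓘(ℝ, ℝ) (fun y => g (e.symm y)) (e p) := by
    refine MDifferentiableAt.comp (e p) (g := g) (f := e.symm) ?_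
      ((mdifferentiable_of_mem_maximalAtlas he).mdifferentiableAt_symm (e.map_source hp))
    rwa [e.left_inv hp]
  have h2 := (mdifferentiableAt_iff_differentiableAt.1 h1).hasFDerivAt
  refine ⟨_, E, h2, hE, hEs, ?_⟩
  have h3 : HasMFDerivAt 𝓘(ℝ, X) 𝓘(ℝ, ℝ) (fun q => g (e.symm (e q))) p
      ((fderiv ℝ (fun y => g (e.symm y)) (e p)).comp E) :=
    HasMFDerivAt.comp (g := fun y => g (e.symm y)) p h2.hasMFDerivAt hE
  refine (h3.congr_of_eventuallyEq ?_).mfderiv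
  filter_upwards [e.open_source.mem_nhds hp] with q hq
  rw [e.left_inv hq]

variable [IsManifold 𝓘(ℝ, X) 1 M] {F : PalaisFinsler X M}

/-- The local bound propagates along the path by continuous induction. The endpoints may lie on the
boundary, where no local bound is known, so the induction starts at `a' > a`; then `a'` tends to `a`
and `L` to `1`. -/
theorem sub_le_pathLength_of_eventually {Ω : Set M} {V : M → ℝ} (hV : ContinuousOn V (closure Ω))
    (hloc : ∀ x ∈ Ω, ∀ L > 1, ∀ᶠ y in 𝓝 x, V y - V x ≤ L * F.fdist x y) {c : ℝ → M} {a b : ℝ}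
    (hc : IsPiecewiseC1Path X c a b) (hin : ∀ t ∈ Ioo a b, c t ∈ Ω)
    (hcl : ∀ t ∈ Icc a b, c t ∈ closure Ω) : V (c b) - V (c a) ≤ F.pathLength c a b := by
  rcases hc.le.eq_or_lt with rfl | hab
  · simp [pathLength]
  have hVc : ContinuousOn (fun t => V (c t)) (Icc a b) := hV.comp hc.continuousOn hcl
  have key : ∀ L > 1, ∀ a' ∈ Ioo a b, V (c b) - V (c a') ≤ L * F.pathLength c a b := by
    intro L hL a' ha'
    have hc' := hc.mono ha'.1.le ha'.2.le le_rfl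
    have hsub : Icc a' b ⊆ Icc a b := Icc_subset_Icc_left ha'.1.le
    have hlen : ContinuousOn (fun t => F.pathLength c a' t) (Icc a' b) := by
      have := intervalIntegral.continuousOn_primitive_interval'
        (hc'.intervalIntegrable_speed (F := F)) left_mem_uIcc
      rwa [uIcc_of_le ha'.2.le] at this
    set s : Set ℝ := {t | V (c t) - V (c a') ≤ L * F.pathLength c a' t} with hs
    have hscl : IsClosed (s ∩ Icc a' b) := by
      have h1 : ContinuousOn (fun t => V (c t) - V (c a') - L * F.pathLength c a' t) (Icc a' b) :=
        ((hVc.mono hsub).sub continuousOn_const).sub (continuousOn_const.mul hlen)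
      have h2 := h1.preimage_isClosed_of_isClosed isClosed_Icc (isClosed_Iic (a := (0 : ℝ)))
      convert h2 using 1
      ext t
      simp only [hs, mem_inter_iff, mem_ofPred_eq, mem_preimage, mem_Iic, sub_nonpos]
      exact and_comm
    have hsub_s := hscl.Icc_subset_of_forall_exists_gt (by simp [hs, pathLength]) (by
      rintro t ⟨hts, ht⟩ t' ht'
      have ht'' : t < t' := ht'
      have hta : t ∈ Ioo a b := ⟨ha'.1.trans_le ht.1, ht.2⟩
      have h1 : ContinuousAt c t := hc.continuousOn.continuousAt (Icc_mem_nhds hta.1 hta.2)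
      have h2 : ∀ᶠ r in 𝓝[>] t, V (c r) - V (c t) ≤ L * F.fdist (c t) (c r) :=
        nhdsWithin_le_nhds (h1.eventually (hloc _ (hin t hta) L hL))
      obtain ⟨r, hr1, hr2⟩ := (h2.and (Ioc_mem_nhdsGT (lt_min ht'' ht.2))).exists
      have hrb : r ≤ b := hr2.2.trans (min_le_right _ _)
      refine ⟨r, ?_, hr2.1, hr2.2.trans (min_le_left _ _)⟩
      have h3 := mul_le_mul_of_nonneg_left
        (fdist_path_le (F := F) hc hta.1.le hr2.1.le hrb) (by linarith : 0 ≤ L)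
      have h4 := (hc.mono ha'.1.le ht.1 ht.2.le).pathLength_add (F := F)
        (hc.mono hta.1.le hr2.1.le hrb)
      have hts : V (c t) - V (c a') ≤ L * F.pathLength c a' t := hts
      change V (c r) - V (c a') ≤ L * F.pathLength c a' r
      rw [← h4, mul_add]
      linarith)
    have h5 : V (c b) - V (c a') ≤ L * F.pathLength c a' b := hsub_s ⟨ha'.2.le, le_rfl⟩
    have h6 := mul_le_mul_of_nonneg_left (pathLength_mono (F := F) hc ha'.1.le ha'.2.le le_rfl)
      (by linarith : 0 ≤ L)
    linarith
  have h1 : ∀ L > 1, V (c b) - V (c a) ≤ L * F.pathLength c a b := by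
    intro L hL
    have h2 : Tendsto (fun t => V (c b) - V (c t)) (𝓝[>] a) (𝓝 (V (c b) - V (c a))) := by
      refine tendsto_const_nhds.sub ?_
      have := (hVc a ⟨le_rfl, hab.le⟩).tendsto
      exact this.mono_left (by
        rw [← nhdsWithin_Ioc_eq_nhdsGT hab]
        exact nhdsWithin_mono a Ioc_subset_Icc_self)
    refine le_of_tendsto h2 ?_
    filter_upwards [Ioo_mem_nhdsGT hab] with t ht using key L hL t ht
  have h3 : Tendsto (fun L : ℝ => L * F.pathLength c a b) (𝓝[>] 1)
      (𝓝 (1 * F.pathLength c a b)) :=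
    (Continuous.tendsto (by fun_prop) 1).mono_left nhdsWithin_le_nhds
  rw [one_mul] at h3
  refine ge_of_tendsto h3 ?_
  filter_upwards [self_mem_nhdsWithin] with L hL using h1 L hL

variable [RegularSpace M] [ConnectedSpace M]

/-- A lower bound on increments suffices: the derivative is linear, so applying it to `v` and `-v`
bounds both sides. -/
theorem dualNorm_mfderiv_le_one {g : M → ℝ} {x : M} (hg : MDifferentiableAt 𝓘(ℝ, X) 𝓘(ℝ, ℝ) g x)
    (h : ∀ᶠ q in 𝓝 x, -F.fdist x q ≤ g q - g x) :
    F.dualNorm x (mfderiv 𝓘(ℝ, X) 𝓘(ℝ, ℝ) g x) ≤ 1 := by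
  have he := IsManifold.chart_mem_maximalAtlas (I := 𝓘(ℝ, X)) (n := 1) x
  have hx := mem_chart_source X x
  set e := chartAt X x
  obtain ⟨A, E, hA, hE, hEs, hAE⟩ := exists_hasFDerivAt_chart he hx hg
  rw [congrArg (F.dualNorm x) hAE]
  refine le_of_forall_pos_le_add fun ε hε => ?_
  obtain ⟨W, hW, hWe, hWd⟩ := F.exists_local_comparison he hx hε
  set n := F.chartSeminorm e (e x)
  have hy₀ := e.map_source hx
  have hnear : ∀ᶠ y in 𝓝 (e x), -((1 + ε) * n (y - e x)) ≤ g (e.symm y) - g (e.symm (e x)) := by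
    have ht : Tendsto e.symm (𝓝 (e x)) (𝓝 x) := by
      have := (e.continuousAt_symm hy₀).tendsto
      rwa [e.left_inv hx] at this
    filter_upwards [ht.eventually h, ht hW, e.open_target.mem_nhds hy₀] with y hy hyW hyt
    have h1 := (hWd x (mem_of_mem_nhds hW) _ hyW).1
    rw [e.right_inv hyt] at h1
    rw [e.left_inv hx]
    linarith
  have key : ∀ v, -((1 + ε) * n v) ≤ A v := by
    intro v
    have h2 := (hasDerivAt_iff_tendsto_slope_zero.1 (hA.hasLineDerivAt v)).mono_left
      (nhdsWithin_mono 0 (fun s (hs : 0 < s) => hs.ne') : 𝓝[>] (0 : ℝ) ≤ 𝓝[≠] 0)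
    refine ge_of_tendsto h2 ?_
    have hc : Tendsto (fun s : ℝ => e x + s • v) (𝓝 0) (𝓝 (e x)) :=
      Continuous.tendsto' (by fun_prop) _ _ (by simp)
    filter_upwards [nhdsWithin_le_nhds (hc.eventually hnear), self_mem_nhdsWithin] with s hs hs0
    have hs0 : 0 < s := hs0
    simp only [zero_add, smul_eq_mul, zero_smul, add_zero]
    rw [add_sub_cancel_left, map_smul_eq_mul, Real.norm_of_nonneg hs0.le] at hs
    rw [le_inv_mul_iff₀ hs0]
    linarith
  refine dualNorm_le (by linarith) fun v => ?_
  rw [← chartNorm_mfderiv he hx hE]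
  have h1 := key (E v)
  have h2 := key (-E v)
  rw [map_neg_eq_map, map_neg] at h2
  exact abs_le.2 ⟨h1, neg_le_neg_iff.1 h2⟩

theorem exists_lt_one_eventually_le {g : M → ℝ} {x : M}
    (hg : MDifferentiableAt 𝓘(ℝ, X) 𝓘(ℝ, ℝ) g x)
    (h : F.dualNorm x (mfderiv 𝓘(ℝ, X) 𝓘(ℝ, ℝ) g x) < 1) :
    ∃ κ < 1, ∀ᶠ q in 𝓝 x, -(κ * F.fdist x q) ≤ g q - g x := by
  have he := IsManifold.chart_mem_maximalAtlas (I := 𝓘(ℝ, X)) (n := 1) x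
  have hx := mem_chart_source X x
  set e := chartAt X x
  obtain ⟨A, E, hA, hE, hEs, hAE⟩ := exists_hasFDerivAt_chart he hx hg
  rw [congrArg (F.dualNorm x) hAE] at h
  set κ₀ := F.dualNorm x (A.comp E)
  have hκ₀ : 0 ≤ κ₀ := dualNorm_nonneg
  have h : κ₀ < 1 := h
  have hAn : ∀ v, |A v| ≤ κ₀ * chartNorm F.nrm e (e x) v := by
    intro v
    obtain ⟨w, rfl⟩ := hEs v
    rw [chartNorm_mfderiv he hx hE]
    exact abs_le_dualNorm_mul (F := F) (x := x) (D := A.comp E) w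
  obtain ⟨K, hK, hn1, hn2⟩ := F.exists_equivalent he hx
  set ε := (1 - κ₀) / 4 with hε
  have hε0 : 0 < ε := by linarith
  obtain ⟨W, hW, hWe, hWd⟩ := F.exists_local_comparison he hx hε0
  refine ⟨(1 + κ₀) / 2 * (1 + ε), by nlinarith, ?_⟩
  have hd := hA.isLittleO.def (show 0 < (1 - κ₀) / 2 / K by
    have : 0 < 1 - κ₀ := by linarith
    positivity)
  filter_upwards [hW, (e.continuousAt hx).eventually hd] with q hqW hq
  rw [e.left_inv hx, e.left_inv (hWe hqW), Real.norm_eq_abs] at hq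
  have h1 := (hWd x (mem_of_mem_nhds hW) q hqW).2
  set n := F.chartSeminorm e (e x)
  have h2 : (1 - κ₀) / 2 / K * ‖e q - e x‖ ≤ (1 - κ₀) / 2 * n (e q - e x) := by
    rw [div_mul_eq_mul_div, div_le_iff₀ hK]
    have := mul_le_mul_of_nonneg_left (hn1 (e q - e x)) (by linarith : 0 ≤ (1 - κ₀) / 2)
    linarith
  have h3 := (abs_le.1 hq).1
  have h4 : -(κ₀ * n (e q - e x)) ≤ A (e q - e x) := (abs_le.1 (hAn (e q - e x))).1
  have h5 := mul_le_mul_of_nonneg_left h1 (by linarith : 0 ≤ (1 + κ₀) / 2)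
  linarith

/-- Ekeland's variational principle for the Finsler distance. -/
theorem exists_ekeland (hF : F.IsComplete) {S : Set M} (hS : IsClosed S) {V : M → ℝ}
    (hV : ContinuousOn V S) {m : ℝ} (hm : ∀ x ∈ S, m ≤ V x) {θ : ℝ} (hθ : 0 < θ) {x₀ : M}
    (hx₀ : x₀ ∈ S) :
    ∃ x ∈ S, V x + θ * F.fdist x₀ x ≤ V x₀ ∧ ∀ y ∈ S, V x - θ * F.fdist x y ≤ V y := by
  -- Each point is followed by an almost minimizer of `V` on the part of `S` lying in its downward
  -- cone, with tolerance `2⁻ᵏ`.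
  have hsel : ∀ (k : ℕ) (x : S), ∃ y : S, V y + θ * F.fdist x y ≤ V x ∧
      ∀ z ∈ S, V z + θ * F.fdist x z ≤ V x → V y ≤ V z + (1 / 2) ^ k := by
    rintro k ⟨x, hx⟩
    set T := V '' {z | z ∈ S ∧ V z + θ * F.fdist x z ≤ V x}
    have hT : BddBelow T := ⟨m, by
      rintro _ ⟨z, hz, rfl⟩
      exact hm z hz.1⟩
    have hTne : T.Nonempty := ⟨_, x, ⟨hx, by rw [fdist_self, mul_zero, add_zero]⟩, rfl⟩
    obtain ⟨_, ⟨y, ⟨hy, hyx⟩, rfl⟩, hlt⟩ := exists_lt_of_csInf_lt hTne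
      (show sInf T < sInf T + (1 / 2) ^ k by
        have : (0 : ℝ) < (1 / 2) ^ k := by positivity
        linarith)
    refine ⟨⟨y, hy⟩, hyx, fun z hz hzx => ?_⟩
    have := csInf_le hT ⟨z, ⟨hz, hzx⟩, rfl⟩
    linarith
  choose sel hsel1 hsel2 using hsel
  obtain ⟨s, hs0, hss⟩ : ∃ s : ℕ → S, s 0 = ⟨x₀, hx₀⟩ ∧ ∀ k, s (k + 1) = sel k (s k) :=
    ⟨fun k => Nat.rec ⟨x₀, hx₀⟩ sel k, rfl, fun k => rfl⟩
  have hs1 : ∀ k, V (s (k + 1)) + θ * F.fdist (s k) (s (k + 1)) ≤ V (s k) := fun k => by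
    rw [hss]
    exact hsel1 k (s k)
  have hs2 : ∀ k, ∀ z ∈ S, V z + θ * F.fdist (s k) z ≤ V (s k) →
      V (s (k + 1)) ≤ V z + (1 / 2) ^ k := fun k => by
    rw [hss]
    exact hsel2 k (s k)
  have hmono : ∀ k l, k ≤ l → V (s l) + θ * F.fdist (s k) (s l) ≤ V (s k) := by
    intro k l hkl
    induction l, hkl using Nat.le_induction with
    | base => rw [fdist_self, mul_zero, add_zero]
    | succ l _ ih =>
      have h1 := mul_le_mul_of_nonneg_left (F.fdist_triangle (s k) (s l) (s (l + 1))) hθ.le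
      linarith [hs1 l]
  have hanti : ∀ k l, k ≤ l → V (s l) ≤ V (s k) := fun k l hkl => by
    have := mul_nonneg hθ.le (fdist_nonneg (F := F) (p := s k) (q := s l))
    linarith [hmono k l hkl]
  have hbdd : BddBelow (range fun k => V (s k)) := ⟨m, by
    rintro _ ⟨k, rfl⟩
    exact hm _ (s k).2⟩
  obtain ⟨x, hx⟩ := hF (fun k => s k) (by
    intro ε hε
    obtain ⟨k₀, hk₀⟩ := exists_lt_of_ciInf_lt
      (show ⨅ k, V (s k) < (⨅ k, V (s k)) + θ * ε by linarith [mul_pos hθ hε])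
    have key : ∀ k l, k₀ ≤ k → k ≤ l → F.fdist (s k) (s l) < ε := by
      intro k l hk hkl
      have h1 := hmono k l hkl
      have h2 := hanti k₀ k hk
      have h3 := ciInf_le hbdd l
      exact lt_of_mul_lt_mul_left (by linarith) hθ.le
    refine ⟨k₀, fun k hk l hl => ?_⟩
    rcases le_total k l with hkl | hkl
    · exact key k l hk hkl
    · rw [fdist_comm]
      exact key l k hl hkl)
  have hlim : Tendsto (fun k => (s k : M)) atTop (𝓝 x) := by
    refine tendsto_def.2 fun U hU => ?_
    obtain ⟨δ, hδ, hδU⟩ := F.exists_ball_subset hU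
    filter_upwards [hx.eventually_lt_const hδ] with k hk
    exact hδU _ (by rwa [fdist_comm])
  have hxS : x ∈ S := hS.mem_of_tendsto hlim (Eventually.of_forall fun k => (s k).2)
  have hVlim : Tendsto (fun k => V (s k)) atTop (𝓝 (V x)) :=
    (hV x hxS).tendsto.comp (tendsto_nhdsWithin_iff.2
      ⟨hlim, Eventually.of_forall fun k => (s k).2⟩)
  have hxk : ∀ k, V x + θ * F.fdist (s k) x ≤ V (s k) := by
    intro k
    have h1 : Tendsto (fun l => V (s l) + θ * F.fdist (s k) (s l)) atTop
        (𝓝 (V x + θ * F.fdist (s k) x)) :=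
      hVlim.add (((F.continuous_fdist (s k)).continuousAt.tendsto.comp hlim).const_mul θ)
    exact le_of_tendsto h1 (eventually_atTop.2 ⟨k, fun l hl => hmono k l hl⟩)
  refine ⟨x, hxS, by simpa [hs0] using hxk 0, fun y hy => ?_⟩
  by_contra! hlt
  -- A point `y` below the cone at `x` lies in the cone of every `s k`, hence was a competitor at
  -- every stage. This forces `V x ≤ V y`.
  have h1 : ∀ k, V x ≤ V y + (1 / 2) ^ k := by
    intro k
    have h2 := mul_le_mul_of_nonneg_left (F.fdist_triangle (s k) x y) hθ.le
    have h3 := hs2 k y hy (by linarith [hxk k])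
    have h4 := hxk (k + 1)
    have h5 := mul_nonneg hθ.le (fdist_nonneg (F := F) (p := s (k + 1)) (q := x))
    linarith
  have h2 : Tendsto (fun k : ℕ => V y + (1 / 2 : ℝ) ^ k) atTop (𝓝 (V y + 0)) :=
    (tendsto_pow_atTop_nhds_zero_of_lt_one (by norm_num) (by norm_num)).const_add _
  have h3 := ge_of_tendsto' h2 h1
  have h4 := mul_nonneg hθ.le (fdist_nonneg (F := F) (p := x) (q := y))
  linarith

/-- A function of slope at most `1` in `Ω` is compared with its values on the boundary along almost
minimizing paths. -/
theorem exists_frontier_abs_sub_le {Ω : Set M} (hΩ : IsOpen Ω) {V : M → ℝ}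
    (hV : ContinuousOn V (closure Ω))
    (hloc : ∀ x ∈ Ω, ∀ L > 1, ∀ᶠ y in 𝓝 x, V y - V x ≤ L * F.fdist x y) {x y : M} (hx : x ∈ Ω)
    (hy : y ∉ Ω) {η : ℝ} (hη : 0 < η) :
    ∃ z ∈ frontier Ω, |V x - V z| + F.fdist z y ≤ F.fdist x y + η := by
  obtain ⟨c, a, b, hab, hc, rfl, rfl, hlt⟩ := F.exists_path_lt x y
    (show F.fdist x y < F.fdist x y + η by linarith)
  obtain ⟨t, ht, htΩ, hbefore⟩ := exists_first_exit hc.continuousOn hΩ hx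
    fun h => hy (h b ⟨hab, le_rfl⟩)
  have hct := hc.mono le_rfl ht.1.le ht.2
  have hcl : ∀ r ∈ Icc a t, c r ∈ closure Ω := by
    have hm : MapsTo c (Ico a t) Ω := hbefore
    have := hm.closure_of_continuousOn (by
      rw [closure_Ico ht.1.ne]
      exact hct.continuousOn)
    rwa [closure_Ico ht.1.ne] at this
  refine ⟨c t, ⟨hcl t ⟨ht.1.le, le_rfl⟩, by rwa [hΩ.interior_eq]⟩, ?_⟩
  have h1 := sub_le_pathLength_of_eventually (F := F) hV hloc hct
    (fun r hr => hbefore r ⟨hr.1.le, hr.2⟩) hcl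
  -- The growth bound is one-sided; the reversed path gives the opposite inequality.
  have h2 := sub_le_pathLength_of_eventually (F := F) hV hloc hct.comp_neg
    (fun r hr => hbefore _ ⟨by linarith [hr.2], by linarith [hr.1]⟩)
    (fun r hr => hcl _ ⟨by linarith [hr.2], by linarith [hr.1]⟩)
  rw [pathLength_comp_neg, neg_neg, neg_neg] at h2
  have h3 := fdist_path_le (F := F) hc ht.1.le ht.2 le_rfl
  have h4 := hct.pathLength_add (F := F) (hc.mono ht.1.le ht.2 le_rfl)
  have h5 : |V (c a) - V (c t)| ≤ F.pathLength c a t := abs_le.2 ⟨by linarith, by linarith⟩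
  linarith

end PalaisFinsler

/-! ### The distance function is the unique viscosity solution. -/

theorem isLocalMax_coe_closure {M : Type*} [TopologicalSpace M] {Ω : Set M} {f : M → ℝ} {x : closure Ω}
    (h : IsLocalMax f (x : M)) : IsLocalMax (fun y : closure Ω => f y) x :=
  (continuous_subtype_val.tendsto x).eventually h

theorem isLocalMin_coe_closure {M : Type*} [TopologicalSpace M] {Ω : Set M} {f : M → ℝ} {x : closure Ω}
    (h : IsLocalMin f (x : M)) : IsLocalMin (fun y : closure Ω => f y) x :=
  (continuous_subtype_val.tendsto x).eventually h

theorem eventually_of_eventually_closure {M : Type*} [TopologicalSpace M] {Ω : Set M} (hΩ : IsOpen Ω) {x : closure Ω}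
    (hx : (x : M) ∈ Ω) {P : M → Prop} (h : ∀ᶠ y : closure Ω in 𝓝 x, P y) :
    ∀ᶠ y in 𝓝 (x : M), P y := by
  rw [← map_nhds_subtype_coe_eq_nhds x.2 (mem_of_superset (hΩ.mem_nhds hx) subset_closure)]
  exact h

namespace PalaisFinsler

variable {X M : Type*} [NormedAddCommGroup X] [NormedSpace ℝ X]
  [TopologicalSpace M] [ChartedSpace X M]

variable [IsManifold 𝓘(ℝ, X) 1 M] {F : PalaisFinsler X M} [RegularSpace M] [ConnectedSpace M]
  {Ω : Set M} {h : frontier Ω → ℝ}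

/-- The function `distanceSolution`, defined on the whole manifold. -/
noncomputable def lipschitzExtension (F : PalaisFinsler X M) (Ω : Set M) (h : frontier Ω → ℝ) (x : M) : ℝ :=
  ⨅ y : frontier Ω, (h y + F.fdist (y : M) x)

theorem lipschitzExtension_le (hh : ∀ y z : frontier Ω, |h y - h z| ≤ F.fdist (y : M) (z : M))
    (x : M) (y : frontier Ω) : F.lipschitzExtension Ω h x ≤ h y + F.fdist (y : M) x := by
  refine ciInf_le ⟨h y - F.fdist (y : M) x, ?_⟩ y
  rintro _ ⟨z, rfl⟩
  have h1 := (abs_le.1 (hh y z)).2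
  have h2 := F.fdist_triangle (y : M) x z
  rw [F.fdist_comm x z] at h2
  simp only
  linarith

variable [Nonempty (frontier Ω)]

theorem lipschitzExtension_sub_le
    (hh : ∀ y z : frontier Ω, |h y - h z| ≤ F.fdist (y : M) (z : M)) (p q : M) :
    F.lipschitzExtension Ω h p - F.lipschitzExtension Ω h q ≤ F.fdist p q := by
  rw [sub_le_comm]
  refine le_ciInf fun y => ?_
  have h1 := lipschitzExtension_le hh p y
  have h2 := F.fdist_triangle (y : M) q p
  rw [F.fdist_comm q p] at h2
  linarith

theorem lipschitzExtension_frontier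
    (hh : ∀ y z : frontier Ω, |h y - h z| ≤ F.fdist (y : M) (z : M)) (y : frontier Ω) :
    F.lipschitzExtension Ω h y = h y := by
  refine le_antisymm ?_ (le_ciInf fun z => ?_)
  · simpa [fdist_self] using lipschitzExtension_le hh (y : M) y
  · have := (abs_le.1 (hh z y)).1
    linarith

theorem continuous_lipschitzExtension
    (hh : ∀ y z : frontier Ω, |h y - h z| ≤ F.fdist (y : M) (z : M)) :
    Continuous (F.lipschitzExtension Ω h) := by
  rw [continuous_iff_continuousAt]
  intro q
  rw [ContinuousAt, Metric.tendsto_nhds]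
  intro ε hε
  filter_upwards [F.eventually_fdist_lt q hε] with q' hq'
  have h1 := lipschitzExtension_sub_le hh q q'
  have h2 := lipschitzExtension_sub_le hh q' q
  rw [F.fdist_comm q' q] at h2
  rw [Real.dist_eq, abs_lt]
  constructor <;> linarith

theorem isViscositySolution_distanceSolution (hΩ : IsOpen Ω)
    (hh : ∀ y z : frontier Ω, |h y - h z| ≤ F.fdist (y : M) (z : M)) :
    F.IsViscositySolution Ω h (F.distanceSolution Ω h) := by
  have hcont : Continuous (F.distanceSolution Ω h) :=
    (continuous_lipschitzExtension hh).comp continuous_subtype_val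
  refine ⟨⟨hcont.upperSemicontinuous, ?_, fun y => (lipschitzExtension_frontier hh y).le⟩,
    ⟨hcont.lowerSemicontinuous, ?_, fun y => (lipschitzExtension_frontier hh y).ge⟩⟩
  · rintro x hx _ ⟨g, hg, hmax, rfl⟩
    refine dualNorm_mfderiv_le_one (hg.mdifferentiable one_ne_zero x) ?_
    filter_upwards [eventually_of_eventually_closure hΩ hx
      (P := fun y => F.lipschitzExtension Ω h y - g y ≤ F.lipschitzExtension Ω h x - g x) hmax]
      with q hq
    linarith [lipschitzExtension_sub_le hh (x : M) q]
  · rintro x hx _ ⟨g, hg, hmin, rfl⟩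
    by_contra! hlt
    obtain ⟨κ, hκ, hgκ⟩ := exists_lt_one_eventually_le (hg.mdifferentiable one_ne_zero (x : M)) hlt
    have hmin := eventually_of_eventually_closure hΩ hx
      (P := fun y => F.lipschitzExtension Ω h x - g x ≤ F.lipschitzExtension Ω h y - g y) hmin
    obtain ⟨δ, hδ, hδs⟩ := F.exists_ball_subset (inter_mem (inter_mem hgκ hmin) (hΩ.mem_nhds hx))
    -- Reaching `p` at distance `δ / 2` towards `y` lowers the function by at least `δ / 2 - 2 * η`,
    -- while `κ` allows only `κ * δ / 2`. The two differ by `4 * η - 2 * η > 0`.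
    set η := δ / 2 * (1 - κ) / 4 with hη
    have hη0 : 0 < η := by
      have : 0 < 1 - κ := by linarith
      positivity
    obtain ⟨y, hy⟩ := exists_lt_of_ciInf_lt
      (show F.lipschitzExtension Ω h x < F.lipschitzExtension Ω h x + η by linarith)
    have hyδ : δ ≤ F.fdist x y := by
      by_contra! hlt
      have := (hδs _ hlt).2
      have := y.2.2
      rw [hΩ.interior_eq] at this
      contradiction
    obtain ⟨p, hp, hpy⟩ := F.exists_fdist_eq_add_le (x : M) y (r := δ / 2) (by positivity)
      (by linarith) hη0
    obtain ⟨⟨h1, h2⟩, -⟩ := hδs p (by linarith)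
    have h1 : -(κ * F.fdist x p) ≤ g p - g x := h1
    have h2 : F.lipschitzExtension Ω h x - g x ≤ F.lipschitzExtension Ω h p - g p := h2
    have h3 := lipschitzExtension_le hh p y
    rw [F.fdist_comm] at h3 hy
    rw [hp] at h1
    have : δ / 2 * (1 - κ) = 4 * η := by rw [hη]; ring
    linarith

theorem eq_distanceSolution [CompleteSpace X] {β : X → ℝ} (hβ : IsUnitBump β) (hF : F.IsComplete)
    (hΩ : IsOpen Ω) (hΩb : F.IsBdd Ω)
    (hh : ∀ y z : frontier Ω, |h y - h z| ≤ F.fdist (y : M) (z : M)) {v : closure Ω → ℝ}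
    (hv : F.IsViscositySolution Ω h v) : v = F.distanceSolution Ω h := by
  obtain ⟨⟨husc, hsub, hble⟩, ⟨hlsc, hsuper, hleb⟩⟩ := hv
  -- The values of `V` off `closure Ω` are irrelevant; the extension allows test functions and paths
  -- on `M` to be used.
  obtain ⟨V, hV⟩ : ∃ V : M → ℝ, ∀ x : closure Ω, V x = v x :=
    ⟨Function.extend Subtype.val v 0, fun x => Subtype.val_injective.extend_apply v 0 x⟩
  have hVc : ContinuousOn V (closure Ω) := by
    rw [continuousOn_iff_continuous_domRestrict]
    have : (closure Ω).domRestrict V = v := funext hV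
    rw [this]
    exact continuous_iff_lower_upperSemicontinuous.2 ⟨hlsc, husc⟩
  have hVΩ : ContinuousOn V Ω := hVc.mono subset_closure
  have hVh : ∀ y : frontier Ω, V y = h y := fun y =>
    (hV ⟨y, frontier_subset_closure y.2⟩).trans (le_antisymm (hble y) (hleb y))
  have hloc : ∀ x ∈ Ω, ∀ L > 1, ∀ᶠ y in 𝓝 x, V y - V x ≤ L * F.fdist x y := fun x hx L hL =>
    F.eventually_sub_le_of_superdifferential hβ hΩ hVΩ (fun x hx g hg hmax =>
      hsub ⟨x, subset_closure hx⟩ hx _ ⟨g, hg, by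
        have := isLocalMax_coe_closure (x := ⟨x, subset_closure hx⟩) hmax
        simpa only [hV] using this, rfl⟩) hx hL
  have hcone : ∀ x ∈ Ω, ∀ θ : ℝ, 0 ≤ θ → θ < 1 →
      ¬ ∀ᶠ y in 𝓝 x, V x - θ * F.fdist x y ≤ V y := fun x hx θ hθ0 hθ =>
    F.not_eventually_sub_le_of_subdifferential hβ hΩ hVΩ (fun x hx g hg hmin =>
      hsuper ⟨x, subset_closure hx⟩ hx _ ⟨g, hg, by
        have := isLocalMin_coe_closure (x := ⟨x, subset_closure hx⟩) hmin
        simpa only [hV] using this, rfl⟩) hx hθ0 hθ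
  -- comparison with the boundary values
  have hbd : ∀ x ∈ closure Ω, ∀ y : frontier Ω, |V x - h y| ≤ F.fdist x y := by
    intro x hx y
    by_cases hxΩ : x ∈ Ω
    · refine le_of_forall_pos_le_add fun η hη => ?_
      have hyΩ : (y : M) ∉ Ω := fun hyΩ => y.2.2 (by rwa [hΩ.interior_eq])
      obtain ⟨z, hz, hzη⟩ := exists_frontier_abs_sub_le hΩ hVc hloc hxΩ hyΩ hη
      have h1 := hh ⟨z, hz⟩ y
      have h2 := hVh ⟨z, hz⟩
      rw [← h2] at h1
      have h3 := abs_sub_le (V x) (V z) (h y)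
      linarith
    · have hxf : x ∈ frontier Ω := ⟨hx, by rwa [hΩ.interior_eq]⟩
      rw [hVh ⟨x, hxf⟩]
      exact hh ⟨x, hxf⟩ y
  obtain ⟨y₀⟩ := ‹Nonempty (frontier Ω)›
  obtain ⟨q₀, hq₀⟩ : Ω.Nonempty := closure_nonempty_iff.1 ⟨y₀, frontier_subset_closure y₀.2⟩
  obtain ⟨C, hC⟩ := hΩb
  have hCcl : ∀ x ∈ closure Ω, F.fdist q₀ x ≤ C := fun x hx =>
    closure_minimal (fun q hq => hC q₀ hq₀ q hq)
      (isClosed_le (F.continuous_fdist q₀) continuous_const) hx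
  have hC2 : ∀ x ∈ closure Ω, ∀ y ∈ closure Ω, F.fdist x y ≤ 2 * C := fun x hx y hy => by
    have h1 := F.fdist_triangle x q₀ y
    rw [F.fdist_comm x q₀] at h1
    linarith [hCcl x hx, hCcl y hy]
  funext x
  rw [← hV x]
  refine le_antisymm (le_ciInf fun y => ?_) ?_
  · have := (abs_le.1 (hbd x x.2 y)).2
    rw [F.fdist_comm]
    linarith
  · have key : ∀ θ ∈ Ioo (0 : ℝ) 1, F.lipschitzExtension Ω h x - (1 - θ) * (2 * C) ≤ V x := by
      rintro θ ⟨hθ0, hθ1⟩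
      obtain ⟨z, hz, hzx, hzmin⟩ := exists_ekeland hF isClosed_closure hVc
        (m := h y₀ - 2 * C) (fun p hp => by
          have := (abs_le.1 (hbd p hp y₀)).1
          linarith [hC2 p hp y₀ (frontier_subset_closure y₀.2)]) hθ0 x.2
      -- Ekeland's point carries a cone of slope `θ < 1` below the graph, which the supersolution
      -- property forbids in `Ω`.
      have hzΩ : z ∉ Ω := fun hzΩ => hcone z hzΩ θ hθ0.le hθ1 <| by
        filter_upwards [hΩ.mem_nhds hzΩ] with q hq using hzmin q (subset_closure hq)
      have hzf : z ∈ frontier Ω := ⟨hz, by rwa [hΩ.interior_eq]⟩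
      have h1 := lipschitzExtension_le hh (x : M) ⟨z, hzf⟩
      have h2 : V z = h ⟨z, hzf⟩ := hVh ⟨z, hzf⟩
      have h3 := mul_le_mul_of_nonneg_left (hC2 x x.2 z hz) (by linarith : 0 ≤ 1 - θ)
      rw [F.fdist_comm] at h1
      linarith
    have ht : Tendsto (fun θ : ℝ => F.lipschitzExtension Ω h x - (1 - θ) * (2 * C)) (𝓝[<] 1)
        (𝓝 (F.lipschitzExtension Ω h x - (1 - 1) * (2 * C))) :=
      (Continuous.tendsto (by fun_prop) 1).mono_left nhdsWithin_le_nhds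
    rw [sub_self, zero_mul, sub_zero] at ht
    refine le_of_tendsto ht ?_
    filter_upwards [Ioo_mem_nhdsLT zero_lt_one] with θ hθ using key θ hθ

end PalaisFinsler

theorem mainTheorem1 {X M : Type*} [NormedAddCommGroup X] [NormedSpace ℝ X] [CompleteSpace X]
    [TopologicalSpace M] [T2Space M] [ParacompactSpace M] [ConnectedSpace M]
    [ChartedSpace X M] [IsManifold 𝓘(ℝ, X) 1 M]
    (hX : HasC1LipschitzBump X)
    (F : PalaisFinsler X M) (hF : F.IsComplete)
    (Ω : Set M) (hΩo : IsOpen Ω) (hΩb : F.IsBdd Ω) (hΩf : (frontier Ω).Nonempty)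
    (h : frontier Ω → ℝ) (hh : ∀ y z : frontier Ω, |h y - h z| ≤ F.fdist (y : M) (z : M)) :
    F.IsViscositySolution Ω h (F.distanceSolution Ω h) ∧
      ∀ v : closure Ω → ℝ, F.IsViscositySolution Ω h v → v = F.distanceSolution Ω h := by
  obtain ⟨β, hβ⟩ := hX.exists_isUnitBump
  have : Nonempty (frontier Ω) := hΩf.to_subtype
  exact ⟨PalaisFinsler.isViscositySolution_distanceSolution hΩo hh,
    fun v hv => PalaisFinsler.eq_distanceSolution hβ hF hΩo hΩb hh hv⟩
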